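/- For $n\ge 1$, write permutations in one-line notation $\sigma=[\sigma_1,\dots,\sigma_n]\in S_n$ and put $|\sigma|=n$. Call $\sigma$ a king permutation if $|\sigma_{i+1}-\sigma_i|>1$ for all $1\le i\le n-1$, and a cylindrical king permutation if, in addition, $|\sigma_1-\sigma_n|>1$ when $n>1$ (so the permutation $[1]$ is of both kinds). Let $\mathbb{K}$ and $\mathbb{CK}$ be the sets of all king permutations and of all cylindrical king permutations, respectively. Write $\pi\prec\sigma$ if $|\pi|<|\sigma|$ and some subsequence of $\sigma$ is order-isomorphic to $\pi$. For $S\in\{\mathbb{K},\mathbb{CK}\}$, say that $\sigma\in S$ covers $\pi\in S$ in $S$ if $\pi\prec\sigma$ and there is no $\tau\in S$ with $\pi\prec\tau\prec\sigma$; the maximal gap of $S$ is the largest value of $|\sigma|-|\pi|$ over all such covering pairs. 1. If $\sigma,\pi\in\mathbb{CK}$ satisfy $\pi\prec\sigma$ and $|\sigma|-|\pi|>4$, then there is some $\tau\in\mathbb{CK}$ with $\pi\prec\tau\prec\sigma$ and $|\sigma|-|\tau|\le 4$. 2. The maximal gap of $\mathbb{CK}$ exists and equals $4$, whereas the maximal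 gap of $\mathbb{K}$ exists and equals $3$. 3. The permutation $[579683142]$ covers $[13524]$ in $\mathbb{CK}$, so a gap of exactly $4$ occurs. -/

import Mathlib

/-- A permutation of `[n]` for some `n`. The entries and the positions are numbered
`0, …, n - 1` here instead of `1, …, n`; every notion below only involves differences and
comparisons of entries and of positions, so the shift is immaterial. -/
abbrev FinPerm : Type := Σ n : ℕ, Equiv.Perm (Fin n)

namespace FinPerm

/-- The order (length) `|σ|` of `σ`. -/
def size (σ : FinPerm) : ℕ := σ.1

/-- `PatternLT π σ` is `π ≺ σ`: the permutation `π` is strictly shorter than `σ`, and some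
subsequence of the one-line notation of `σ` is order-isomorphic to that of `π`. -/
def PatternLT (π σ : FinPerm) : Prop :=
  π.size < σ.size ∧
    ∃ f : Fin π.1 → Fin σ.1, StrictMono f ∧ ∀ i j, π.2 i < π.2 j ↔ σ.2 (f i) < σ.2 (f j)

/-- The king permutations: consecutive entries differ by more than `1`. -/
def King : Set FinPerm :=
  {σ | 1 ≤ σ.size ∧
    ∀ i j : Fin σ.1, (i : ℕ) + 1 = (j : ℕ) → 1 < |((σ.2 j : ℕ) : ℤ) - ((σ.2 i : ℕ) : ℤ)|}

/-- The cylindrical king permutations: moreover the first and the last entry differ by more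
than `1`. The condition `i ≠ j` only matters for the permutation of order one, whose first and
last entries are the same entry, and which counts as a cylindrical king permutation. -/
def CylKing : Set FinPerm :=
  {σ | σ ∈ King ∧
    ∀ i j : Fin σ.1, (i : ℕ) = 0 → (j : ℕ) + 1 = σ.1 → i ≠ j →
      1 < |((σ.2 i : ℕ) : ℤ) - ((σ.2 j : ℕ) : ℤ)|}

/-- `π` is covered by `σ` in the poset formed by the members of `S` under containment. -/
def CoveredIn (S : Set FinPerm) (π σ : FinPerm) : Prop :=
  π ∈ S ∧ σ ∈ S ∧ PatternLT π σ ∧ ¬ ∃ τ ∈ S, PatternLT π τ ∧ PatternLT τ σ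

/-- The gaps of the poset `S`: the differences `|σ| - |π|` where `σ` covers `π` in `S`. -/
def gaps (S : Set FinPerm) : Set ℕ :=
  {d | ∃ π σ : FinPerm, CoveredIn S π σ ∧ σ.size = π.size + d}

/-- The permutation `[579683142]`, with all entries lowered by one. -/
def perm579683142 : FinPerm :=
  ⟨9, { toFun := ![4, 6, 8, 5, 7, 2, 0, 3, 1]
        invFun := ![6, 8, 5, 7, 0, 3, 1, 4, 2]
        left_inv := by decide
        right_inv := by decide }⟩

/-- The permutation `[13524]`, with all entries lowered by one. -/
def perm13524 : FinPerm :=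
  ⟨5, { toFun := ![0, 2, 4, 1, 3]
        invFun := ![0, 3, 1, 4, 2]
        left_inv := by decide
        right_inv := by decide }⟩

end FinPerm

set_option linter.unusedSectionVars false

/-! ### Separable patterns: sum decompositions and bonds. -/

namespace KingPoset

open Finset

variable {ι : Type*} [DecidableEq ι]

/-! A permutation is treated as a finite point set with positions `p` and values `q`; king means
free of bonds. A pattern avoiding 2413 and 3142 is a direct or skew sum, hence has a bond once it
has two points (`exists_bond`). So a king subset S of T meets each separable interval of T in at
most one point, and a king set with two points contains 2413 or 3142. Cylindrical kings are handled
alongside kings by a set P of position functions: `{p}` in the linear case, all rotations of `p` in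
the cylindrical one.

Let S ⊂ N be king with |N| - |S| ≥ 4, and suppose no king set containing S has intermediate size.
For x ∉ S, deleting x and then two more points outside S exposes three bonds, which lift to
separable intervals of N \ x. If no separable interval had three points, x would separate three
pairs in position or value, while each coordinate can account for only one; so one with three points
exists (`exists_large_blk`). Let B be a largest one. If B ∪ {x} is not an interval of N, then B
contains z with N \ z king, and y such that every bond of N \ y uses z. Then z ∈ S, y ∉ S, and the
same argument for y is contradictory. Hence for some x, J = B ∪ {x} is an interval of N; it can be
replaced by any nonempty king subset of itself, and S = (N \ J) ∪ {s} with s ∈ J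
(`exists_interval`).

Linear case: replacing J by a 2413 or 3142 inside it gives a set with |S| + 3 points that contains a
copy of S, with s moved within J. So gaps in 𝕂 are at most 3. Cylindrical case: J may straddle the
cut, and moving s could then rotate the pattern. Instead s is kept, inside a king subset of J with
at most five points, so gaps in ℂ𝕂 are at most 4. The bounds are attained by 2413 over 1 and by
579683142 over 13524; in the latter J is the wrapped interval formed by 3142 and the leading 5. -/

/-- `c` lies strictly between `a` and `b` with respect to `f`. -/
def IsBetween (f : ι → ℤ) (a c b : ι) : Prop :=
  (f a < f c ∧ f c < f b) ∨ (f b < f c ∧ f c < f a)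

/-- No element of `T` outside `C` lies between two elements of `C`. -/
def Itv (f : ι → ℤ) (C T : Finset ι) : Prop :=
  ∀ a ∈ C, ∀ b ∈ C, ∀ c ∈ T, f a < f c → f c < f b → c ∈ C

/-- The points `a` and `b` of `W` are neighbours in position and in value. -/
def Bond (p q : ι → ℤ) (W : Finset ι) (a b : ι) : Prop :=
  a ∈ W ∧ b ∈ W ∧ a ≠ b ∧ ∀ c ∈ W, ¬ IsBetween p a c b ∧ ¬ IsBetween q a c b

/-- The point set `W` has no bond. -/
def KingOn (p q : ι → ℤ) (W : Finset ι) : Prop := ∀ a b, ¬ Bond p q W a b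

/-- The four points form one of the patterns `2413` and `3142`. -/
def Quad (p q : ι → ℤ) (a b c d : ι) : Prop :=
  p a < p b ∧ p b < p c ∧ p c < p d ∧
    ((q c < q a ∧ q a < q d ∧ q d < q b) ∨ (q b < q d ∧ q d < q a ∧ q a < q c))

/-- The point set `C` avoids the patterns `2413` and `3142`. -/
def QuadFree (p q : ι → ℤ) (C : Finset ι) : Prop :=
  ∀ a ∈ C, ∀ b ∈ C, ∀ c ∈ C, ∀ d ∈ C, ¬ Quad p q a b c d

/-- `C` is an interval of `T` in position and in value, and its pattern is separable. -/
def Blk (p q : ι → ℤ) (T C : Finset ι) : Prop :=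
  C ⊆ T ∧ Itv p C T ∧ Itv q C T ∧ QuadFree p q C

variable {p q f g : ι → ℤ} {C T U V W : Finset ι}

lemma QuadFree.mono (h : QuadFree p q C) (hU : U ⊆ C) : QuadFree p q U :=
  fun a ha b hb c hc d hd => h a (hU ha) b (hU hb) c (hU hc) d (hU hd)

lemma Bond.symm {a b : ι} (h : Bond p q W a b) : Bond p q W b a := by
  obtain ⟨h1, h2, h3, h4⟩ := h
  exact ⟨h2, h1, h3.symm, fun c hc => by have := h4 c hc; unfold IsBetween at *; tauto⟩

lemma Bond.swap {a b : ι} (h : Bond p q W a b) : Bond q p W a b :=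
  ⟨h.1, h.2.1, h.2.2.1, fun c hc => (h.2.2.2 c hc).symm⟩

lemma QuadFree.swap (h : QuadFree p q C) : QuadFree q p C := by
  rintro a ha b hb c hc d hd ⟨h1, h2, h3, h4 | h4⟩
  · exact h c hc a ha d hd b hb ⟨by omega, by omega, by omega, by omega⟩
  · exact h b hb d hd a ha c hc ⟨by omega, by omega, by omega, by omega⟩

lemma QuadFree.neg (h : QuadFree p q C) : QuadFree p (-q) C := by
  rintro a ha b hb c hc d hd ⟨h1, h2, h3, h4⟩
  refine h a ha b hb c hc d hd ⟨h1, h2, h3, ?_⟩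
  simp only [Pi.neg_apply] at h4; omega

lemma Bond.of_itv {a b : ι} (hUC : U ⊆ C) (hp : Itv p U C) (hq : Itv q U C)
    (h : Bond p q U a b) : Bond p q C a b := by
  obtain ⟨h1, h2, h3, h4⟩ := h
  refine ⟨hUC h1, hUC h2, h3, fun c hc => ⟨fun hb => ?_, fun hb => ?_⟩⟩
  · have : c ∈ U := by
      rcases hb with hb | hb
      · exact hp a h1 b h2 c hc hb.1 hb.2
      · exact hp b h2 a h1 c hc hb.1 hb.2
    exact (h4 c this).1 hb
  · have : c ∈ U := by
      rcases hb with hb | hb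
      · exact hq a h1 b h2 c hc hb.1 hb.2
      · exact hq b h2 a h1 c hc hb.1 hb.2
    exact (h4 c this).2 hb

/-- `C` is the direct or skew sum of the nonempty sets `U` and `V`. -/
def Splits (p q : ι → ℤ) (C U V : Finset ι) : Prop :=
  U.Nonempty ∧ V.Nonempty ∧ U ∪ V = C ∧ (∀ u ∈ U, ∀ v ∈ V, p u < p v) ∧
    ((∀ u ∈ U, ∀ v ∈ V, q u < q v) ∨ (∀ u ∈ U, ∀ v ∈ V, q v < q u))

lemma Splits.neg (h : Splits p (-q) C U V) : Splits p q C U V := by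
  obtain ⟨h1, h2, h3, h4, h5⟩ := h
  refine ⟨h1, h2, h3, h4, ?_⟩
  simpa [or_comm] using h5

/-- Induction step when the rest is a direct sum; the skew case follows by negating values. The
rightmost point `r` joins `V` if it is above `U`, is a skew summand if it is below `U`, and
otherwise `U` is cut at the height of `r`. -/
lemma exists_splits_insert {r : ι} (hpi : Function.Injective p) (hq : Function.Injective q)
    (hr : ∀ c ∈ C, p c < p r) (hC : QuadFree p q (insert r C))
    (hU : U.Nonempty) (hV : V.Nonempty) (hUV : U ∪ V = C) (hp : ∀ u ∈ U, ∀ v ∈ V, p u < p v)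
    (hlt : ∀ u ∈ U, ∀ v ∈ V, q u < q v) : ∃ U' V', Splits p q (insert r C) U' V' := by
  have hUC : ∀ u ∈ U, u ∈ C := fun u hu => hUV ▸ mem_union_left _ hu
  have hVC : ∀ u ∈ V, u ∈ C := fun u hu => hUV ▸ mem_union_right _ hu
  have hrC : r ∉ C := fun h => lt_irrefl _ (hr r h)
  obtain ⟨v₀, hv₀⟩ := hV
  by_cases h1 : ∀ u ∈ U, q u < q r
  · refine ⟨U, insert r V, hU, ⟨r, by simp⟩, by rw [← hUV]; ext; simp, ?_, Or.inl ?_⟩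
    · intro u hu v hv
      rcases mem_insert.1 hv with rfl | hv
      exacts [hr u (hUC u hu), hp u hu v hv]
    · intro u hu v hv
      rcases mem_insert.1 hv with rfl | hv
      exacts [h1 u hu, hlt u hu v hv]
  by_cases h2 : ∀ u ∈ U, q r < q u
  · obtain ⟨u₀, hu₀⟩ := hU
    refine ⟨C, {r}, ⟨u₀, hUC _ hu₀⟩, ⟨r, by simp⟩, by ext; simp, ?_, Or.inr ?_⟩
    · intro u hu v hv
      rw [mem_singleton.1 hv]; exact hr u hu
    · intro u hu v hv
      rw [mem_singleton.1 hv]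
      rw [← hUV, mem_union] at hu
      rcases hu with hu | hu
      exacts [h2 u hu, (h2 u₀ hu₀).trans (hlt u₀ hu₀ u hu)]
  push Not at h1 h2
  obtain ⟨u₁, hu₁, h1⟩ := h1
  obtain ⟨u₂, hu₂, h2⟩ := h2
  have hne : ∀ u ∈ U, q u ≠ q r := fun u hu h => hrC (hq h ▸ hUC u hu)
  refine ⟨U.filter (fun u => q u < q r), insert r (U.filter (fun u => q r < q u) ∪ V),
    ⟨u₂, ?_⟩, ⟨r, by simp⟩, ?_, ?_, Or.inl ?_⟩
  · simp [hu₂, lt_of_le_of_ne h2 (hne _ hu₂)]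
  · rw [← hUV]
    ext c
    simp only [mem_union, mem_insert, mem_filter]
    have := hne c
    constructor
    · tauto
    · rintro (h | h | h)
      · tauto
      · rcases lt_or_gt_of_ne (this h) with h' | h' <;> tauto
      · tauto
  · intro u hu v hv
    simp only [mem_union, mem_insert, mem_filter] at hu hv
    rcases hv with rfl | ⟨hv, hv'⟩ | hv
    · exact hr u (hUC u hu.1)
    · by_contra! hlt'
      have h3 : p v ≠ p u := by
        intro h
        rw [hpi h] at hv'
        exact lt_asymm hv' hu.2
      -- An upper point `v` of `U` to the left of a lower one `u` makes `v u v₀ r` a 3142.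
      refine hC v (by simp [hUC v hv]) u (by simp [hUC u hu.1]) v₀ (by simp [hVC _ hv₀]) r
        (by simp) ⟨by omega, hp u hu.1 _ hv₀, hr _ (hVC _ hv₀), Or.inr ⟨hu.2, hv', hlt v hv _ hv₀⟩⟩
    · exact hp u hu.1 v hv
  · intro u hu v hv
    simp only [mem_union, mem_insert, mem_filter] at hu hv
    rcases hv with rfl | ⟨hv, hv'⟩ | hv
    · exact hu.2
    · exact hu.2.trans hv'
    · exact hlt u hu.1 v hv

lemma exists_splits (hpi : Function.Injective p) (hqi : Function.Injective q) :
    ∀ C : Finset ι, QuadFree p q C → 2 ≤ #C → ∃ U V, Splits p q C U V := by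
  intro C
  induction C using Finset.induction_on_max_value p with
  | empty => simp
  | insert r C hrC hr ih =>
    intro hC h2
    rw [card_insert_of_notMem hrC] at h2
    have hr' : ∀ c ∈ C, p c < p r := fun c hc =>
      lt_of_le_of_ne (hr c hc) fun h => hrC (hpi h ▸ hc)
    rcases Nat.lt_or_ge 1 #C with h1 | h1
    · obtain ⟨U, V, hU, hV, hUV, hp, hq | hq⟩ := ih (hC.mono (subset_insert _ _)) h1
      · exact exists_splits_insert hpi hqi hr' hC hU hV hUV hp hq
      · obtain ⟨U', V', h⟩ := exists_splits_insert hpi (neg_injective.comp hqi) hr' hC.neg hU hV hUV hp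
          (fun u hu v hv => by simpa using hq u hu v hv)
        exact ⟨U', V', Splits.neg h⟩
    · obtain ⟨a, rfl⟩ := card_eq_one.1 (by omega : #C = 1)
      refine ⟨{a}, {r}, by simp, by simp, by ext; simp [or_comm], by simpa using hr', ?_⟩
      have : q a ≠ q r := fun h => hrC (by simp [hqi h])
      simpa using lt_or_gt_of_ne this

lemma Splits.itv_left (h : Splits p q C U V) (hp : Itv p C T) (hq : Itv q C T) :
    Itv p U T ∧ Itv q U T := by
  obtain ⟨-, -, rfl, h1, h2⟩ := h
  constructor
  · intro a ha b hb c hc hac hcb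
    rcases mem_union.1 (hp a (mem_union_left _ ha) b (mem_union_left _ hb) c hc hac hcb) with h | h
    · exact h
    · exact absurd (h1 b hb c h) (by omega)
  · intro a ha b hb c hc hac hcb
    rcases mem_union.1 (hq a (mem_union_left _ ha) b (mem_union_left _ hb) c hc hac hcb) with h | h
    · exact h
    · rcases h2 with h2 | h2
      · exact absurd (h2 b hb c h) (by omega)
      · exact absurd (h2 a ha c h) (by omega)

lemma Splits.itv_right (h : Splits p q C U V) (hp : Itv p C T) (hq : Itv q C T) :
    Itv p V T ∧ Itv q V T := by
  obtain ⟨-, -, rfl, h1, h2⟩ := h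
  constructor
  · intro a ha b hb c hc hac hcb
    rcases mem_union.1 (hp a (mem_union_right _ ha) b (mem_union_right _ hb) c hc hac hcb) with h | h
    · exact absurd (h1 c h a ha) (by omega)
    · exact h
  · intro a ha b hb c hc hac hcb
    rcases mem_union.1 (hq a (mem_union_right _ ha) b (mem_union_right _ hb) c hc hac hcb) with h | h
    · rcases h2 with h2 | h2
      · exact absurd (h2 c h a ha) (by omega)
      · exact absurd (h2 c h b hb) (by omega)
    · exact h

lemma itv_self : Itv f C C := fun _ _ _ _ _ hc _ _ => hc

lemma Splits.left_subset (h : Splits p q C U V) : U ⊆ C := h.2.2.1 ▸ subset_union_left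
lemma Splits.right_subset (h : Splits p q C U V) : V ⊆ C := h.2.2.1 ▸ subset_union_right

lemma Splits.disjoint (h : Splits p q C U V) : Disjoint U V :=
  disjoint_left.2 fun a ha hb => lt_irrefl _ (h.2.2.2.1 a ha a hb)

lemma Splits.card (h : Splits p q C U V) : #C = #U + #V := by
  rw [← h.2.2.1, card_union_of_disjoint h.disjoint]

lemma bond_pair {a b : ι} (h : a ≠ b) : Bond p q {a, b} a b := by
  refine ⟨by simp, by simp, h, ?_⟩
  simp [IsBetween]

/-- A separable pattern with at least two entries has a bond. -/
lemma exists_bond (hpi : Function.Injective p) (hqi : Function.Injective q) :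
    ∀ C : Finset ι, QuadFree p q C → 2 ≤ #C → ∃ a b, Bond p q C a b := by
  intro C
  induction C using Finset.strongInduction with
  | H C ih =>
    intro hC h2
    obtain ⟨U, V, h⟩ := exists_splits hpi hqi C hC h2
    have hcard := h.card
    have hU := h.1.card_pos
    have hV := h.2.1.card_pos
    by_cases hU2 : 2 ≤ #U
    · obtain ⟨a, b, hab⟩ := ih U ⟨h.left_subset, fun h' => by
        have := card_le_card h'; omega⟩ (hC.mono h.left_subset) hU2
      exact ⟨a, b, hab.of_itv h.left_subset (h.itv_left itv_self itv_self).1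
        (h.itv_left itv_self itv_self).2⟩
    by_cases hV2 : 2 ≤ #V
    · obtain ⟨a, b, hab⟩ := ih V ⟨h.right_subset, fun h' => by
        have := card_le_card h'; omega⟩ (hC.mono h.right_subset) hV2
      exact ⟨a, b, hab.of_itv h.right_subset (h.itv_right itv_self itv_self).1
        (h.itv_right itv_self itv_self).2⟩
    obtain ⟨a, b, hab, rfl⟩ := card_eq_two.1 (by omega : #C = 2)
    exact ⟨a, b, bond_pair hab⟩
end KingPoset

/-! ### Deleting a point of a separable interval. -/

namespace KingPoset

open Finset

variable {ι : Type*} [DecidableEq ι]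
variable {p q f g : ι → ℤ} {B C T U V W : Finset ι}

/-- `x` lies between two elements of `C` with respect to `f`. -/
def SplitBy (f : ι → ℤ) (x : ι) (C : Finset ι) : Prop :=
  ∃ a ∈ C, ∃ b ∈ C, f a < f x ∧ f x < f b

/-- `e` lies between `x` and all of `C` with respect to `f`. -/
def SepBy (f : ι → ℤ) (x e : ι) (C : Finset ι) : Prop :=
  (∀ b ∈ C, f x < f e ∧ f e < f b) ∨ (∀ b ∈ C, f b < f e ∧ f e < f x)

/-- No element outside of `insert x B` extends the interval `B`. -/
def NoCorner (f g : ι → ℤ) (x : ι) (B : Finset ι) : Prop :=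
  ∀ c, c ∉ B → c ≠ x → ∀ d ∈ B, ∃ e, e ∉ B ∧ e ≠ x ∧ (IsBetween f c e d ∨ IsBetween g c e d)

lemma NoCorner.swap {x : ι} (h : NoCorner f g x B) : NoCorner g f x B := by
  intro c hc hx d hd
  obtain ⟨e, h1, h2, h3⟩ := h c hc hx d hd
  exact ⟨e, h1, h2, h3.symm⟩

lemma IsBetween.symm {a b c : ι} (h : IsBetween f a c b) : IsBetween f b c a := Or.symm h

/-- If an element of an interval lies between two outer points, then so do all of them. -/
lemma Itv.btw {a b c d : ι} (hf : Function.Injective f) (h : Itv f C T) (hc : c ∈ T) (hc' : c ∉ C)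
    (hd : d ∈ T) (hd' : d ∉ C) (ha : a ∈ C) (hb : b ∈ C) (hcd : IsBetween f c a d) : IsBetween f c b d := by
  have hbc : f b ≠ f c := fun h => hc' (hf h ▸ hb)
  have hbd : f b ≠ f d := fun h => hd' (hf h ▸ hb)
  rcases hcd with ⟨h1, h2⟩ | ⟨h1, h2⟩
  · refine Or.inl ⟨?_, ?_⟩
    · by_contra h3
      exact hc' (h b hb a ha c hc (by omega) h1)
    · by_contra h3
      exact hd' (h a ha b hb d hd h2 (by omega))
  · refine Or.inr ⟨?_, ?_⟩
    · by_contra h3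
      exact hd' (h b hb a ha d hd (by omega) h1)
    · by_contra h3
      exact hc' (h a ha b hb c hc h2 (by omega))

/-- Since `x` cuts `B.erase y` in two and `d` lies beyond the whole of `B`, the part of `B` on the
side of `d` supplies a second separator. -/
lemma SplitBy.btw [Fintype ι] {x y d : ι} (hf : Function.Injective f) (hB : Itv f B (univ.erase x))
    (hy : y ∈ B) (hs : SplitBy f x (B.erase y)) (hd : d ∉ B) (hdx : d ≠ x) (h : IsBetween f x y d) :
    ∃ b ∈ B, b ≠ y ∧ IsBetween f x b d := by
  obtain ⟨a, ha, b, hb, hax, hxb⟩ := hs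
  rw [mem_erase] at ha hb
  have hda : f a ≠ f d := fun h => hd (hf h ▸ ha.2)
  have hdb : f b ≠ f d := fun h => hd (hf h ▸ hb.2)
  rcases h with ⟨h1, h2⟩ | ⟨h1, h2⟩
  · refine ⟨b, hb.2, hb.1, Or.inl ⟨hxb, ?_⟩⟩
    by_contra h3
    exact hd (hB y hy b hb.2 d (by simp [hdx]) h2 (by omega))
  · refine ⟨a, ha.2, ha.1, Or.inr ⟨?_, hax⟩⟩
    by_contra h3
    exact hd (hB a ha.2 y hy d (by simp [hdx]) (by omega) h1)

lemma KingOn.btw_of_bond_erase [Fintype ι] {y c d : ι} (hN : KingOn f g univ)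
    (hcd : Bond f g (univ.erase y) c d) : IsBetween f c y d ∨ IsBetween g c y d := by
  by_contra! h
  refine hN c d ⟨mem_univ _, mem_univ _, hcd.2.2.1, fun e _ => ?_⟩
  by_cases hey : e = y
  · exact hey ▸ h
  · exact hcd.2.2.2 e (by simp [hey])

/-- Deleting `y` creates bonds only inside `B`: any other pair separated by `y` is still separated,
by another point of `B`, by `e`, or by the separator that `NoCorner` provides. -/
lemma mem_of_bond_erase [Fintype ι] {x y e c d : ι} (hf : Function.Injective f)
    (hg : Function.Injective g) (hN : KingOn f g univ) (hxB : x ∉ B) (hBf : Itv f B (univ.erase x))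
    (hBg : Itv g B (univ.erase x)) (hkey : NoCorner f g x B) (hy : y ∈ B)
    (hs : SplitBy f x (B.erase y)) (he : e ∉ B) (hsep : SepBy g x e B)
    (hcd : Bond f g (univ.erase y) c d) : c ∈ B := by
  by_contra hc
  have hbtw := hN.btw_of_bond_erase hcd
  obtain ⟨-, -, hne, hno⟩ := hcd
  have hno' : ∀ e, e ≠ y → ¬ IsBetween f c e d ∧ ¬ IsBetween g c e d := fun e he => hno e (by simp [he])
  have hey : e ≠ y := fun h => he (h ▸ hy)
  obtain ⟨a, ha, -⟩ := id hs
  rw [mem_erase] at ha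
  have key : ∀ d', d' ∉ B → d' ≠ x → IsBetween f x y d' ∨ IsBetween g x y d' →
      ∃ e, e ≠ y ∧ (IsBetween f x e d' ∨ IsBetween g x e d') := by
    rintro d' hd' hdx (h | h)
    · obtain ⟨b, -, hb, h⟩ := hs.btw hf hBf hy hd' hdx h
      exact ⟨b, hb, Or.inl h⟩
    · refine ⟨e, hey, Or.inr ?_⟩
      unfold IsBetween at *
      rcases hsep with hsep | hsep <;> have := hsep y hy <;> omega
  by_cases hcx : c = x
  · subst hcx
    by_cases hd : d ∈ B
    · refine (hno' e hey).2 ?_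
      unfold IsBetween
      rcases hsep with hsep | hsep <;> have := hsep d hd <;> omega
    · obtain ⟨e', h1, h2⟩ := key d hd hne.symm hbtw
      have := hno' e' h1
      tauto
  by_cases hd : d ∈ B
  · obtain ⟨e', h1, h2, h3⟩ := hkey c hc hcx d hd
    have := hno' e' (fun h => h1 (h ▸ hy))
    tauto
  by_cases hdx : d = x
  · subst hdx
    obtain ⟨e', h1, h2⟩ := key c hc hne (hbtw.imp IsBetween.symm IsBetween.symm)
    have := hno' e' h1
    have := h2.imp IsBetween.symm IsBetween.symm
    tauto
  have hcT : c ∈ univ.erase x := by simp [hcx]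
  have hdT : d ∈ univ.erase x := by simp [hdx]
  rcases hbtw with h | h
  · exact (hno' a ha.1).1 (hBf.btw hf hcT hc hdT hd hy ha.2 h)
  · exact (hno' a ha.1).2 (hBg.btw hg hcT hc hdT hd hy ha.2 h)

/-- `z` is extreme in `C` in position and in value. -/
def Corner (f g : ι → ℤ) (C : Finset ι) (z : ι) : Prop :=
  ∀ c ∈ C.erase z, ∀ d ∈ C.erase z, ¬ IsBetween f c z d ∧ ¬ IsBetween g c z d

lemma Corner.itv {z : ι} (h : Corner f g C z) (hf : Itv f C T) (hg : Itv g C T) :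
    Itv f (C.erase z) T ∧ Itv g (C.erase z) T := by
  constructor
  · intro a ha b hb c hc hac hcb
    refine mem_erase.2 ⟨?_, hf a (mem_of_mem_erase ha) b (mem_of_mem_erase hb) c hc hac hcb⟩
    rintro rfl
    exact (h a ha b hb).1 (Or.inl ⟨hac, hcb⟩)
  · intro a ha b hb c hc hac hcb
    refine mem_erase.2 ⟨?_, hg a (mem_of_mem_erase ha) b (mem_of_mem_erase hb) c hc hac hcb⟩
    rintro rfl
    exact (h a ha b hb).2 (Or.inl ⟨hac, hcb⟩)

/-- `C` has a bond because it is separable, and the full set has none, so `x` separates its two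
ends. -/
lemma split_or_split [Fintype ι] {x : ι} (hf : Function.Injective f) (hg : Function.Injective g)
    (hN : KingOn f g univ) (hC : Blk f g (univ.erase x) C) (h2 : 2 ≤ #C) :
    SplitBy f x C ∨ SplitBy g x C := by
  obtain ⟨hCT, hCf, hCg, hfree⟩ := hC
  obtain ⟨a, b, hab⟩ := exists_bond hf hg C hfree h2
  rcases hN.btw_of_bond_erase (hab.of_itv hCT hCf hCg) with (h | h) | (h | h)
  exacts [Or.inl ⟨a, hab.1, b, hab.2.1, h⟩, Or.inl ⟨b, hab.2.1, a, hab.1, h⟩,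
    Or.inr ⟨a, hab.1, b, hab.2.1, h⟩, Or.inr ⟨b, hab.2.1, a, hab.1, h⟩]

lemma SplitBy.mono {x : ι} (h : SplitBy f x U) (hU : U ⊆ C) : SplitBy f x C := by
  obtain ⟨a, ha, b, hb, h⟩ := h
  exact ⟨a, hU ha, b, hU hb, h⟩

/-- If both summands had two points, `x` would lie strictly inside each of them with respect to `f`,
although one wholly precedes the other. So one summand is a single point, and that point is a
corner. -/
lemma exists_corner [Fintype ι] {x : ι} (hf : Function.Injective f) (hg : Function.Injective g)
    (hN : KingOn f g univ) (hC : Blk f g (univ.erase x) C) (h2 : 2 ≤ #C) (hx : ¬ SplitBy g x C) :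
    ∃ z ∈ C, Corner f g C z := by
  obtain ⟨hCT, hCf, hCg, hfree⟩ := id hC
  obtain ⟨U, V, h⟩ := exists_splits hf hg C hfree h2
  have hU : ¬ (2 ≤ #U ∧ 2 ≤ #V) := by
    rintro ⟨hU2, hV2⟩
    have h1 := (split_or_split hf hg hN ⟨h.left_subset.trans hCT, (h.itv_left hCf hCg).1,
      (h.itv_left hCf hCg).2, hfree.mono h.left_subset⟩ hU2).resolve_right
      (fun h' => hx (h'.mono h.left_subset))
    have h2 := (split_or_split hf hg hN ⟨h.right_subset.trans hCT, (h.itv_right hCf hCg).1,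
      (h.itv_right hCf hCg).2, hfree.mono h.right_subset⟩ hV2).resolve_right
      (fun h' => hx (h'.mono h.right_subset))
    obtain ⟨-, -, u, hu, -, hu'⟩ := h1
    obtain ⟨v, hv, -, -, hv', -⟩ := h2
    have := h.2.2.2.1 u hu v hv
    omega
  have hUpos := h.1.card_pos
  have hVpos := h.2.1.card_pos
  have hd := h.disjoint
  obtain ⟨-, -, rfl, h4, h5⟩ := h
  have h6 : #U = 1 ∨ #V = 1 := by omega
  rcases h6 with h6 | h6
  · obtain ⟨z, rfl⟩ := card_eq_one.1 h6
    refine ⟨z, by simp, fun c hc d hd => ?_⟩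
    have hc : c ∈ V := by simpa [(mem_erase.1 hc).1] using mem_of_mem_erase hc
    have hd : d ∈ V := by simpa [(mem_erase.1 hd).1] using mem_of_mem_erase hd
    have := h4 z (by simp) c hc
    have := h4 z (by simp) d hd
    unfold IsBetween
    rcases h5 with h5 | h5 <;> have := h5 z (by simp) c hc <;> have := h5 z (by simp) d hd <;> omega
  · obtain ⟨z, rfl⟩ := card_eq_one.1 h6
    refine ⟨z, by simp, fun c hc d hd => ?_⟩
    have hc : c ∈ U := by simpa [(mem_erase.1 hc).1] using mem_of_mem_erase hc
    have hd : d ∈ U := by simpa [(mem_erase.1 hd).1] using mem_of_mem_erase hd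
    have := h4 c hc z (by simp)
    have := h4 d hd z (by simp)
    unfold IsBetween
    rcases h5 with h5 | h5 <;> have := h5 c hc z (by simp) <;> have := h5 d hd z (by simp) <;> omega

/-- A separable interval of the complement of `x` has two elements whose removal creates at most
bonds that contain the first of them. -/
lemma exists_removable [Fintype ι] {x e : ι} (hf : Function.Injective f)
    (hg : Function.Injective g) (hN : KingOn f g univ) (hB : Blk f g (univ.erase x) B)
    (h3 : 3 ≤ #B) (hkey : NoCorner f g x B) (hx : ¬ SplitBy g x B) (he : e ∉ B)
    (hsep : SepBy g x e B) :
    ∃ z ∈ B, ∃ y ∈ B, y ≠ z ∧ Corner f g B z ∧ SplitBy f x (B.erase z) ∧ SplitBy f x (B.erase y) ∧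
      KingOn f g (univ.erase z) ∧ ∀ c d, Bond f g (univ.erase y) c d → c = z ∨ d = z := by
  obtain ⟨hBT, hBf, hBg, hfree⟩ := id hB
  have hxB : x ∉ B := fun h => by simpa using hBT h
  have hmem : ∀ y ∈ B, SplitBy f x (B.erase y) → ∀ c d, Bond f g (univ.erase y) c d →
      c ∈ B.erase y ∧ d ∈ B.erase y := fun y hy hs c d hcd =>
    ⟨mem_erase.2 ⟨ne_of_mem_erase hcd.1,
      mem_of_bond_erase hf hg hN hxB hBf hBg hkey hy hs he hsep hcd⟩,
     mem_erase.2 ⟨ne_of_mem_erase hcd.2.1,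
      mem_of_bond_erase hf hg hN hxB hBf hBg hkey hy hs he hsep hcd.symm⟩⟩
  obtain ⟨z, hz, hcz⟩ := exists_corner hf hg hN hB (by omega) hx
  have hB'card : #(B.erase z) = #B - 1 := card_erase_of_mem hz
  have hB' : Blk f g (univ.erase x) (B.erase z) :=
    ⟨(erase_subset _ _).trans hBT, (hcz.itv hBf hBg).1, (hcz.itv hBf hBg).2,
      hfree.mono (erase_subset _ _)⟩
  have hx' : ¬ SplitBy g x (B.erase z) := fun h => hx (h.mono (erase_subset _ _))
  have hs := (split_or_split hf hg hN hB' (by omega)).resolve_right hx'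
  -- `z` would have to separate the ends of a bond lying in `B.erase z`, which a corner never does.
  have hNz : KingOn f g (univ.erase z) := by
    intro c d hcd
    obtain ⟨hc, hd⟩ := hmem z hz hs c d hcd
    have := hcz c hc d hd
    have := hN.btw_of_bond_erase hcd
    tauto
  suffices ∃ y ∈ B.erase z, Corner f g (B.erase z) y ∧ SplitBy f x (B.erase y) by
    obtain ⟨y, hy, hcy, hsy⟩ := this
    refine ⟨z, hz, y, mem_of_mem_erase hy, ne_of_mem_erase hy, hcz, hs, hsy, hNz, ?_⟩
    intro c d hcd
    by_contra! h
    obtain ⟨hc, hd⟩ := hmem y (mem_of_mem_erase hy) hsy c d hcd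
    simp only [mem_erase] at hc hd
    have := hcy c (by simp [hc, h.1]) d (by simp [hd, h.2])
    have := hN.btw_of_bond_erase hcd
    tauto
  rcases Nat.lt_or_ge 3 #B with h4 | h4
  · obtain ⟨y, hy, hcy⟩ := exists_corner hf hg hN hB' (by omega) hx'
    refine ⟨y, hy, hcy, ?_⟩
    have hB'' : Blk f g (univ.erase x) ((B.erase z).erase y) :=
      ⟨(erase_subset _ _).trans hB'.1, (hcy.itv hB'.2.1 hB'.2.2.1).1,
        (hcy.itv hB'.2.1 hB'.2.2.1).2, hB'.2.2.2.mono (erase_subset _ _)⟩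
    have hsub : (B.erase z).erase y ⊆ B := (erase_subset _ _).trans (erase_subset _ _)
    have hcard : #((B.erase z).erase y) = #(B.erase z) - 1 := card_erase_of_mem hy
    refine SplitBy.mono ((split_or_split hf hg hN hB'' (by omega)).resolve_right
      (fun h => hx (h.mono hsub))) (erase_subset_erase _ (erase_subset _ _))
  -- When `B` has three points, `x` lies between the two others; `y` is the one on the side of `z`,
  -- so that `x` still splits `B.erase y`.
  · obtain ⟨a, ha, b, hb, hax, hxb⟩ := hs
    have hab : a ≠ b := by rintro rfl; omega
    have hB'eq : B.erase z = {a, b} := by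
      refine (eq_of_subset_of_card_le ?_ ?_).symm
      · simp [insert_subset_iff, ha, hb]
      · rw [card_pair hab]; omega
    have hcz' := (hcz a ha b hb).1
    have hzx : f z ≠ f x := fun h => hxB (hf h ▸ hz)
    have haz := ne_of_mem_erase ha
    have hbz := ne_of_mem_erase hb
    have haB := mem_of_mem_erase ha
    have hbB := mem_of_mem_erase hb
    rw [hB'eq]
    by_cases h : f z < f x
    · refine ⟨a, by simp, ?_, z, by simp [hz, haz.symm], b, by simp [hbB, hab.symm], h, hxb⟩
      intro c hc d hd
      have hc' : c = b := by simp only [mem_erase, mem_insert, mem_singleton] at hc; tauto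
      have hd' : d = b := by simp only [mem_erase, mem_insert, mem_singleton] at hd; tauto
      subst hc'; subst hd'
      unfold IsBetween; omega
    · refine ⟨b, by simp, ?_, a, by simp [haB, hab], z, by simp [hz, hbz.symm], hax, by omega⟩
      intro c hc d hd
      have hc' : c = a := by simp only [mem_erase, mem_insert, mem_singleton] at hc; tauto
      have hd' : d = a := by simp only [mem_erase, mem_insert, mem_singleton] at hd; tauto
      subst hc'; subst hd'
      unfold IsBetween; omega
end KingPoset

/-! ### Families of position functions, and replacing an interval. -/

namespace KingPoset

open Finset

variable {ι : Type*} [DecidableEq ι]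
variable {p p' q f g : ι → ℤ} {B C J Q S T U V W : Finset ι} {P : Set (ι → ℤ)}

/-- The position functions in `P` are injective, and any two of them have the same betweenness
relation up to passing from an arc to the complementary arc. -/
def IsFrame (P : Set (ι → ℤ)) : Prop :=
  (∀ p ∈ P, Function.Injective p) ∧ ∀ p ∈ P, ∀ p' ∈ P, ∀ c d,
    (∀ e, IsBetween p' c e d ↔ IsBetween p c e d) ∨
      ∀ e, e ≠ c → e ≠ d → (IsBetween p' c e d ↔ ¬ IsBetween p c e d)

/-- The set `W` has no bond for any of the position functions in `P`. -/
def KingFor (P : Set (ι → ℤ)) (q : ι → ℤ) (W : Finset ι) : Prop := ∀ p ∈ P, KingOn p q W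

/-- Either `p` is the only position function, or `C` is enclosed by two elements of `S`. -/
def Wide (P : Set (ι → ℤ)) (S : Finset ι) (p : ι → ℤ) (C : Finset ι) : Prop :=
  (∀ p' ∈ P, p' = p) ∨ ∃ a ∈ S, ∃ b ∈ S, ∀ c ∈ C, p a < p c ∧ p c < p b

/-- Every separable interval is enclosed by `S` for some position function in `P`. -/
def Recuttable (P : Set (ι → ℤ)) (q : ι → ℤ) (S : Finset ι) : Prop :=
  ∀ T C, ∀ p ∈ P, S ⊆ T → Blk p q T C → ∃ p' ∈ P, Blk p' q T C ∧ Wide P S p' C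

/-- If `p` and `p'` see complementary arcs between `c` and `d`, the two points of `S` enclosing `C`
lie on the closed `p`-arc from `c` to `d`, and `C` is trapped between them. -/
lemma Wide.compare {c d : ι} (hP : IsFrame P) (hp : p ∈ P) (hp' : p' ∈ P) (hw : Wide P S p C)
    (hW : S \ C ⊆ W) (hcd : ∀ e ∈ W, ¬ IsBetween p' c e d) :
    (∀ e, IsBetween p' c e d ↔ IsBetween p c e d) ∨
      ((∀ e, e ≠ c → e ≠ d → (IsBetween p' c e d ↔ ¬ IsBetween p c e d)) ∧ ∀ b ∈ C, IsBetween p c b d) := by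
  rcases hw with hw | ⟨a, ha, b, hb, hab⟩
  · rw [hw p' hp']; simp
  rcases hP.2 p hp p' hp' c d with h | h
  · exact Or.inl h
  refine Or.inr ⟨h, fun x hx => ?_⟩
  have haW : a ∈ W := hW (mem_sdiff.2 ⟨ha, fun h => lt_irrefl _ (hab a h).1⟩)
  have hbW : b ∈ W := hW (mem_sdiff.2 ⟨hb, fun h => lt_irrefl _ (hab b h).2⟩)
  have h1 : a = c ∨ a = d ∨ IsBetween p c a d := by
    by_contra! h'
    exact hcd a haW ((h a h'.1 h'.2.1).2 h'.2.2)
  have h2 : b = c ∨ b = d ∨ IsBetween p c b d := by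
    by_contra! h'
    exact hcd b hbW ((h b h'.1 h'.2.1).2 h'.2.2)
  have h3 := hab x hx
  unfold IsBetween at *
  rcases h1 with rfl | rfl | h1 <;> rcases h2 with rfl | rfl | h2 <;> omega

/-- Two common points would make `S ∩ C` a separable interval of `S`, whose bond is a bond of `S`.
-/
lemma Blk.card_inter_le (hP : IsFrame P) (hq : Function.Injective q) (hp : p ∈ P)
    (hS : KingFor P q S) (hST : S ⊆ T) (hC : Blk p q T C) : #(S ∩ C) ≤ 1 := by
  by_contra! h
  obtain ⟨hCT, hCp, hCq, hfree⟩ := hC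
  obtain ⟨a, b, hab⟩ := exists_bond (hP.1 p hp) hq _ (hfree.mono inter_subset_right) h
  refine hS p hp a b (hab.of_itv inter_subset_left ?_ ?_)
  · intro a ha b hb c hc h1 h2
    exact mem_inter.2 ⟨hc, hCp a (mem_inter.1 ha).2 b (mem_inter.1 hb).2 c (hST hc) h1 h2⟩
  · intro a ha b hb c hc h1 h2
    exact mem_inter.2 ⟨hc, hCq a (mem_inter.1 ha).2 b (mem_inter.1 hb).2 c (hST hc) h1 h2⟩

/-- Replacing an interval of a king set by a king subset of it gives a king set. -/
lemma KingFor.replace [Fintype ι] (hP : IsFrame P) (hq : Function.Injective q) (hp : p ∈ P)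
    (hN : KingFor P q univ) (hw : Wide P S p J) (hJp : Itv p J univ) (hJq : Itv q J univ)
    (hkey : ∀ c, c ∉ J → ∀ d ∈ J, ∃ e, e ∉ J ∧ (IsBetween p c e d ∨ IsBetween q c e d))
    (hQ : Q.Nonempty) (hQJ : Q ⊆ J) (hQk : KingOn p q Q) : KingFor P q (univ \ J ∪ Q) := by
  have hp1 := hP.1 p hp
  have hmem : ∀ e, e ∉ J → e ∈ univ \ J ∪ Q := fun e he => by simp [he]
  intro p' hp' c d hcd
  have hmix : ∀ c d, c ∉ J → d ∈ Q → (∀ e ∈ univ \ J ∪ Q, ¬ IsBetween p c e d ∧ ¬ IsBetween q c e d) → False := by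
    intro c d hc hd h
    obtain ⟨e, he, h'⟩ := hkey c hc d (hQJ hd)
    have := h e (hmem e he)
    tauto
  obtain ⟨x, hx⟩ := hQ
  rcases Wide.compare hP hp hp' hw
    (fun e he => hmem e (mem_sdiff.1 he).2) (fun e he => (hcd.2.2.2 e he).1) with h | ⟨h, hJ⟩
  · have hcd' : Bond p q (univ \ J ∪ Q) c d :=
      ⟨hcd.1, hcd.2.1, hcd.2.2.1, fun e he => ⟨fun h' => (hcd.2.2.2 e he).1 ((h e).2 h'),
        (hcd.2.2.2 e he).2⟩⟩
    by_cases hcJ : c ∈ J <;> by_cases hdJ : d ∈ J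
    · have hc : c ∈ Q := by simpa [hcJ] using hcd.1
      have hd : d ∈ Q := by simpa [hdJ] using hcd.2.1
      exact hQk c d ⟨hc, hd, hcd.2.2.1, fun e he => hcd'.2.2.2 e (mem_union_right _ he)⟩
    · have hc : c ∈ Q := by simpa [hcJ] using hcd.1
      exact hmix d c hdJ hc hcd'.symm.2.2.2
    · have hd : d ∈ Q := by simpa [hdJ] using hcd.2.1
      exact hmix c d hcJ hd hcd'.2.2.2
    · refine hN p hp c d ⟨mem_univ _, mem_univ _, hcd.2.2.1, fun e _ => ?_⟩
      by_cases he : e ∈ J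
      · exact ⟨fun h' => (hcd'.2.2.2 x (by simp [hx])).1 (hJp.btw hp1 (mem_univ _) hcJ
          (mem_univ _) hdJ he (hQJ hx) h'), fun h' => (hcd'.2.2.2 x (by simp [hx])).2
          (hJq.btw hq (mem_univ _) hcJ (mem_univ _) hdJ he (hQJ hx) h')⟩
      · exact hcd'.2.2.2 e (hmem e he)
  -- Here `J` lies off the `p'`-arc from `c` to `d`, so restoring it separates nothing in position;
  -- in value, all points of `J` act like `x`.
  · have hcJ : c ∉ J := fun hc => by have := hJ c hc; unfold IsBetween at this; omega
    have hdJ : d ∉ J := fun hc => by have := hJ d hc; unfold IsBetween at this; omega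
    refine hN p' hp' c d ⟨mem_univ _, mem_univ _, hcd.2.2.1, fun e _ => ?_⟩
    by_cases he : e ∈ J
    · exact ⟨fun h' => (h e (fun h => hcJ (h ▸ he)) (fun h => hdJ (h ▸ he))).1 h' (hJ e he),
        fun h' => (hcd.2.2.2 x (by simp [hx])).2
          (hJq.btw hq (mem_univ _) hcJ (mem_univ _) hdJ he (hQJ hx) h')⟩
    · exact hcd.2.2.2 e (hmem e he)

lemma Itv.insert_of_no_btw {c d : ι} (hC : Itv f C T) (hd : d ∈ C) (hf : Function.Injective f)
    (h : ∀ e ∈ T, e ∉ C → ¬ IsBetween f c e d) : Itv f (insert c C) T := by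
  intro a ha b hb e he hae heb
  by_contra hne
  rw [mem_insert, not_or] at hne
  have h1 := h e he hne.2
  have h2 : f e ≠ f d := fun h => hne.2 (hf h ▸ hd)
  have h3 : f e ≠ f c := fun h => hne.1 (hf h)
  unfold IsBetween at h1
  rcases mem_insert.1 ha with rfl | ha' <;> rcases mem_insert.1 hb with rfl | hb'
  · omega
  · exact hne.2 (hC d hd b hb' e he (by omega) heb)
  · exact hne.2 (hC a ha' d hd e he hae (by omega))
  · exact hne.2 (hC a ha' b hb' e he hae heb)

/-- Two elements of a pattern `2413` or `3142` are separated by a third one. -/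
lemma Quad.sep {a b c d : ι} (h : Quad p q a b c d) :
    (IsBetween q a d b) ∧ (IsBetween p a b c) ∧ (IsBetween p a c d) ∧ (IsBetween q b a c ∨ IsBetween q b d c) ∧ IsBetween p b c d ∧
      IsBetween q c a d := by
  obtain ⟨h1, h2, h3, h4⟩ := h
  unfold IsBetween
  omega

/-- No entry of 2413 or 3142 is extreme both in position and in value. -/
lemma QuadFree.insert_corner {x : ι} (hC : QuadFree p q C)
    (hp : (∀ b ∈ C, p x < p b) ∨ ∀ b ∈ C, p b < p x)
    (hq : (∀ b ∈ C, q x < q b) ∨ ∀ b ∈ C, q b < q x) : QuadFree p q (insert x C) := by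
  intro a ha b hb c hc d hd h
  have hab := h
  obtain ⟨h1, h2, h3, h4⟩ := hab
  have key : ∀ y, y ∈ insert x C → y ≠ x → ((p x < p y ∨ p y < p x)) := by
    intro y hy hyx
    have := (mem_insert.1 hy).resolve_left hyx
    rcases hp with hp | hp <;> have := hp y this <;> tauto
  have mem : ∀ y ∈ insert x C, y ≠ x → y ∈ C := fun y hy h => (mem_insert.1 hy).resolve_left h
  have ne : ∀ y z, p y < p z → y ≠ z := fun y z h => by rintro rfl; omega
  by_cases ax : a = x
  · subst ax
    have hc := mem c hc (ne _ _ (h1.trans h2)).symm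
    have hd := mem d hd (ne _ _ (h1.trans (h2.trans h3))).symm
    have hb := mem b hb (ne _ _ h1).symm
    rcases hq with hq | hq <;> have := hq b hb <;> have := hq c hc <;> omega
  by_cases bx : b = x
  · subst bx
    have ha := mem a ha ax
    have hc := mem c hc (ne _ _ h2).symm
    rcases hp with hp | hp <;> have := hp a ha <;> have := hp c hc <;> omega
  by_cases cx : c = x
  · subst cx
    have hb := mem b hb bx
    have hd := mem d hd (ne _ _ h3).symm
    rcases hp with hp | hp <;> have := hp b hb <;> have := hp d hd <;> omega
  by_cases dx : d = x
  · subst dx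
    have hb := mem b hb bx
    have hc := mem c hc cx
    rcases hq with hq | hq <;> have := hq b hb <;> have := hq c hc <;> omega
  exact hC a (mem a ha ax) b (mem b hb bx) c (mem c hc cx) d (mem d hd dx) h

lemma Itv.out {x : ι} (hf : Function.Injective f) (hC : Itv f C T) (hx : x ∈ T) (hxC : x ∉ C) :
    (∀ b ∈ C, f x < f b) ∨ ∀ b ∈ C, f b < f x := by
  by_contra! h
  obtain ⟨⟨a, ha, h1⟩, b, hb, h2⟩ := h
  have : f a ≠ f x := fun h => hxC (hf h ▸ ha)
  have : f b ≠ f x := fun h => hxC (hf h ▸ hb)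
  exact hxC (hC a ha b hb x hx (by omega) (by omega))

lemma Blk.insert_corner {c d : ι} (hp : Function.Injective p) (hq : Function.Injective q)
    (hC : Blk p q T C) (hc : c ∈ T) (hcC : c ∉ C) (hd : d ∈ C)
    (h : ∀ e ∈ T, e ∉ C → ¬ IsBetween p c e d ∧ ¬ IsBetween q c e d) : Blk p q T (insert c C) :=
  ⟨insert_subset hc hC.1, hC.2.1.insert_of_no_btw hd hp fun e he he' => (h e he he').1,
    hC.2.2.1.insert_of_no_btw hd hq fun e he he' => (h e he he').2,
    hC.2.2.2.insert_corner (hC.2.1.out hp hc hcC) (hC.2.2.1.out hq hc hcC)⟩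

/-- A largest separable interval of the complement of `x`. -/
lemma exists_largest_blk [Fintype ι] {x : ι} (hP : IsFrame P) (hq : Function.Injective q)
    (hrec : Recuttable P q S) (hx : x ∉ S)
    (h : ∃ p ∈ P, ∃ C, Blk p q (univ.erase x) C ∧ 3 ≤ #C) :
    ∃ p ∈ P, ∃ B, Blk p q (univ.erase x) B ∧ 3 ≤ #B ∧ Wide P S p B ∧ NoCorner p q x B := by
  classical
  obtain ⟨p₀, hp₀, C₀, hC₀, hC₀3⟩ := h
  -- Maximising over all of `P` at once keeps `B` largest when it is recut; an extending point would
  -- be a corner and enlarge `B`.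
  let F : Finset (Finset ι) := univ.filter fun C => ∃ p ∈ P, Blk p q (univ.erase x) C
  have hF : C₀ ∈ F := by simpa [F] using ⟨p₀, hp₀, hC₀⟩
  obtain ⟨B, hB, hmax⟩ := F.exists_max_image card ⟨C₀, hF⟩
  simp only [F, mem_filter, mem_univ, true_and] at hB hmax
  obtain ⟨p₁, hp₁, hB⟩ := hB
  obtain ⟨p, hp, hB, hw⟩ := hrec _ _ p₁ hp₁ (fun s hs => by
    simpa using (fun h => hx (h ▸ hs) : s ≠ x)) hB
  refine ⟨p, hp, B, hB, hC₀3.trans (hmax C₀ ⟨p₀, hp₀, hC₀⟩), hw, ?_⟩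
  intro c hc hcx d hd
  by_contra! hno
  have := hmax _ ⟨p, hp, hB.insert_corner (hP.1 p hp) hq (by simp [hcx]) hc hd
    fun e he he' => hno e he' (ne_of_mem_erase he)⟩
  rw [card_insert_of_notMem hc] at this
  omega
end KingPoset

/-! ### Locating the interval that contains everything outside `S`. -/

namespace KingPoset

open Finset

variable {ι : Type*} [DecidableEq ι] [Fintype ι]
variable {p p' q f g : ι → ℤ} {B C J Q S T U V W : Finset ι} {P : Set (ι → ℤ)}

/-- On complementary arcs all of `B` is `p`-between `c` and `d`, so `y` can separate them only in
value. Then another point of `B` does so too, by `hs` if one end is `x` and by the interval property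
otherwise. -/
lemma Bond.erase_of_wide {x y c d : ι} (hP : IsFrame P) (hq : Function.Injective q)
    (hN : KingFor P q univ) (hp : p ∈ P) (hp' : p' ∈ P) (hB : Blk p q (univ.erase x) B)
    (hw : Wide P S p B) (hy : y ∈ B)
    (hs : SplitBy p x (B.erase y) ∨ SplitBy q x (B.erase y))
    (hcd : Bond p' q (univ.erase y) c d) : Bond p q (univ.erase y) c d := by
  have hsub : S \ B ⊆ univ.erase y := fun t ht => by
    simp only [mem_erase, mem_univ, and_true]
    rintro rfl
    exact (mem_sdiff.1 ht).2 hy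
  rcases Wide.compare hP hp hp' hw hsub (fun e he => (hcd.2.2.2 e he).1) with h | ⟨h, hJ⟩
  · exact ⟨hcd.1, hcd.2.1, hcd.2.2.1, fun e he => ⟨fun h' => (hcd.2.2.2 e he).1 ((h e).2 h'),
      (hcd.2.2.2 e he).2⟩⟩
  exfalso
  have hcB : c ∉ B := fun hc => by have := hJ c hc; unfold IsBetween at this; omega
  have hdB : d ∉ B := fun hc => by have := hJ d hc; unfold IsBetween at this; omega
  have hq' : IsBetween q c y d := ((hN p' hp').btw_of_bond_erase hcd).resolve_left fun h' =>
    (h y (fun h => hcB (h ▸ hy)) (fun h => hdB (h ▸ hy))).1 h' (hJ y hy)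
  have hno : ∀ e, e ≠ y → ¬ IsBetween q c e d := fun e he => (hcd.2.2.2 e (by simp [he])).2
  have key : ∀ d, d ∉ B → d ≠ x → (∀ b ∈ B, IsBetween p x b d) → IsBetween q x y d →
      ∃ e, e ≠ y ∧ IsBetween q x e d := by
    intro d hd hdx hall hyd
    rcases hs with ⟨a, ha, b, hb, h1, h2⟩ | hs
    · have := hall a (mem_of_mem_erase ha)
      have := hall b (mem_of_mem_erase hb)
      unfold IsBetween at this
      unfold IsBetween at *
      omega
    · obtain ⟨b, -, hb, h⟩ := hs.btw hq hB.2.2.1 hy hd hdx hyd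
      exact ⟨b, hb, h⟩
  by_cases hcx : c = x
  · subst hcx
    obtain ⟨e, he, h'⟩ := key d hdB hcd.2.2.1.symm hJ hq'
    exact hno e he h'
  by_cases hdx : d = x
  · subst hdx
    obtain ⟨e, he, h'⟩ := key c hcB hcd.2.2.1 (fun b hb => (hJ b hb).symm) hq'.symm
    exact hno e he h'.symm
  obtain ⟨a, ha⟩ : ∃ a, a ∈ B.erase y := by
    rcases hs with ⟨a, ha, -⟩ | ⟨a, ha, -⟩ <;> exact ⟨a, ha⟩
  exact hno a (ne_of_mem_erase ha) (hB.2.2.1.btw hq (by simp [hcx]) hcB (by simp [hdx]) hdB hy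
    (mem_of_mem_erase ha) hq')

lemma SplitBy.itv_insert {x : ι} (h : SplitBy f x B) (hB : Itv f B (univ.erase x)) :
    Itv f (insert x B) univ := by
  obtain ⟨u, hu, v, hv, hux, hxv⟩ := h
  intro a ha b hb c _ hac hcb
  by_cases hcx : c = x
  · simp [hcx]
  refine mem_insert_of_mem ?_
  have hc : c ∈ univ.erase x := by simp [hcx]
  rcases mem_insert.1 ha with rfl | ha' <;> rcases mem_insert.1 hb with rfl | hb'
  · omega
  · exact hB u hu b hb' c hc (by omega) hcb
  · exact hB a ha' v hv c hc hac (by omega)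
  · exact hB a ha' b hb' c hc hac hcb

lemma exists_sepBy {x : ι} (hf : Function.Injective f) (hxB : x ∉ B)
    (hB : Itv f B (univ.erase x)) (hs : ¬ SplitBy f x B) (hJ : ¬ Itv f (insert x B) univ) :
    ∃ e, e ∉ B ∧ SepBy f x e B := by
  have hout : (∀ b ∈ B, f x < f b) ∨ ∀ b ∈ B, f b < f x := by
    by_contra! h
    obtain ⟨⟨a, ha, h1⟩, b, hb, h2⟩ := h
    have : f a ≠ f x := fun h => hxB (hf h ▸ ha)
    have : f b ≠ f x := fun h => hxB (hf h ▸ hb)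
    exact hs ⟨a, ha, b, hb, by omega, by omega⟩
  unfold Itv at hJ
  push Not at hJ
  obtain ⟨a, ha, b, hb, c, -, hac, hcb, hc⟩ := hJ
  rw [mem_insert, not_or] at hc
  have hcT : c ∈ univ.erase x := by simp [hc.1]
  have hne : ∀ b ∈ B, f c ≠ f b := fun b hb h => hc.2 (hf h ▸ hb)
  refine ⟨c, hc.2, ?_⟩
  rcases mem_insert.1 ha with rfl | ha' <;> rcases mem_insert.1 hb with rfl | hb'
  · omega
  · refine Or.inl fun b' hb'' => ⟨hac, ?_⟩
    by_contra h
    have := hne b' hb''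
    exact hc.2 (hB b' hb'' b hb' c hcT (by omega) hcb)
  · refine Or.inr fun b' hb'' => ⟨?_, hcb⟩
    by_contra h
    have := hne b' hb''
    exact hc.2 (hB a ha' b' hb'' c hcT hac (by omega))
  · exact absurd (hB a ha' b hb' c hcT hac hcb) hc.2

lemma Blk.swap (h : Blk p q T C) : Blk q p T C := ⟨h.1, h.2.2.1, h.2.1, h.2.2.2.swap⟩

lemma KingOn.swap (h : KingOn p q W) : KingOn q p W := fun a b hab => h a b hab.swap

lemma Corner.swap {z : ι} (h : Corner p q C z) : Corner q p C z :=
  fun c hc d hd => (h c hc d hd).symm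

/-- Either a separable interval of the complement of `x` becomes an interval when `x` is added, or
it has an element whose removal is harmless. -/
lemma itv_insert_or_removable {x : ι} (hP : IsFrame P) (hq : Function.Injective q)
    (hN : KingFor P q univ) (hp : p ∈ P) (hB : Blk p q (univ.erase x) B) (h3 : 3 ≤ #B)
    (hw : Wide P S p B) (hkey : NoCorner p q x B) :
    (Itv p (insert x B) univ ∧ Itv q (insert x B) univ) ∨
      ∃ z ∈ B, ∃ y ∈ B, y ≠ z ∧ Blk p q (univ.erase x) (B.erase z) ∧ KingFor P q (univ.erase z) ∧
        ∀ p' ∈ P, ∀ c d, Bond p' q (univ.erase y) c d → c = z ∨ d = z := by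
  by_cases hJ : Itv p (insert x B) univ ∧ Itv q (insert x B) univ
  · exact Or.inl hJ
  refine Or.inr ?_
  have hxB : x ∉ B := fun h => by simpa using hB.1 h
  have hp1 := hP.1 p hp
  -- `x` splits `B` in one coordinate, which makes `insert x B` an interval there. The failure is
  -- thus in the other coordinate, where some `e` lies between `x` and `B`.
  by_cases hsp : SplitBy p x B
  · have hJq : ¬ Itv q (insert x B) univ := fun h => hJ ⟨hsp.itv_insert hB.2.1, h⟩
    have hsq : ¬ SplitBy q x B := fun h => hJq (h.itv_insert hB.2.2.1)
    obtain ⟨e, he, hsep⟩ := exists_sepBy hq hxB hB.2.2.1 hsq hJq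
    obtain ⟨z, hz, y, hy, hyz, hcz, hz', hy', hk, hb⟩ :=
      exists_removable hp1 hq (hN p hp) hB h3 hkey hsq he hsep
    refine ⟨z, hz, y, hy, hyz, ⟨(erase_subset _ _).trans hB.1, (hcz.itv hB.2.1 hB.2.2.1).1,
      (hcz.itv hB.2.1 hB.2.2.1).2, hB.2.2.2.mono (erase_subset _ _)⟩, ?_, ?_⟩
    · exact fun p' hp' c d h => hk c d (h.erase_of_wide hP hq hN hp hp' hB hw hz (Or.inl hz'))
    · exact fun p' hp' c d h => hb c d (h.erase_of_wide hP hq hN hp hp' hB hw hy (Or.inl hy'))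
  · have hsq := (split_or_split hp1 hq (hN p hp) hB (by omega)).resolve_left hsp
    have hJp : ¬ Itv p (insert x B) univ := fun h => hJ ⟨h, hsq.itv_insert hB.2.2.1⟩
    obtain ⟨e, he, hsep⟩ := exists_sepBy hp1 hxB hB.2.1 hsp hJp
    obtain ⟨z, hz, y, hy, hyz, hcz, hz', hy', hk, hb⟩ :=
      exists_removable hq hp1 (hN p hp).swap hB.swap h3 hkey.swap hsp he hsep
    refine ⟨z, hz, y, hy, hyz, ⟨(erase_subset _ _).trans hB.1, (hcz.swap.itv hB.2.1 hB.2.2.1).1,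
      (hcz.swap.itv hB.2.1 hB.2.2.1).2, hB.2.2.2.mono (erase_subset _ _)⟩, ?_, ?_⟩
    · exact fun p' hp' c d h => hk c d (h.erase_of_wide hP hq hN hp hp' hB hw hz (Or.inr hz')).swap
    · exact fun p' hp' c d h => hb c d (h.erase_of_wide hP hq hN hp hp' hB hw hy (Or.inr hy')).swap

/-- If no king set lies strictly between `S` and the whole set, then some interval contains exactly
one element of `S` and everything outside it belongs to `S`. -/
lemma exists_interval (hP : IsFrame P) (hq : Function.Injective q) (hrec : Recuttable P q S)
    (hS : KingFor P q S) (hN : KingFor P q univ) (hcard : #S < Fintype.card ι)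
    (hmid : ∀ W, S ⊆ W → KingFor P q W → #S < #W → #W < Fintype.card ι → False)
    (hlarge : ∀ x ∉ S, ∃ p ∈ P, ∃ C, Blk p q (univ.erase x) C ∧ 3 ≤ #C) :
    ∃ p ∈ P, ∃ J, ∃ s ∈ S, Itv p J univ ∧ Itv q J univ ∧ s ∈ J ∧ univ \ J ∪ {s} = S ∧
      ∀ Q ⊆ J, Q.Nonempty → KingOn p q Q → KingFor P q (univ \ J ∪ Q) := by
  have hsub : ∀ x ∉ S, S ⊆ univ.erase x := fun x hx s hs => by
    simpa using (fun h => hx (h ▸ hs) : s ≠ x)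
  have herase : ∀ x ∉ S, ∀ W : Finset ι, W = univ.erase x → #S + 1 < Fintype.card ι →
      ¬ KingFor P q W := by
    rintro x hx W rfl hc hk
    have : #(univ.erase x) = Fintype.card ι - 1 := by simp
    exact hmid _ (hsub x hx) hk (by omega) (by omega)
  obtain ⟨x₀, hx₀⟩ : ∃ x, x ∉ S := by
    by_contra! h
    rw [eq_univ_iff_forall.2 h] at hcard
    exact lt_irrefl _ hcard
  -- At least two points of a three-point block avoid `S`, and so does `x₀`.
  have hcard2 : #S + 1 < Fintype.card ι := by
    obtain ⟨p, hp, C, hC, hC3⟩ := hlarge x₀ hx₀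
    have h1 := hC.card_inter_le hP hq hp hS (hsub x₀ hx₀)
    have h2 := card_union_add_card_inter S C
    have h3 : #(S ∪ C) ≤ #(univ.erase x₀) := card_le_card (union_subset (hsub x₀ hx₀) hC.1)
    have : #(univ.erase x₀) = Fintype.card ι - 1 := by simp
    omega
  obtain ⟨x, hx, p, hp, B, hB, hB3, hw, hkey, hJp, hJq⟩ : ∃ x ∉ S, ∃ p ∈ P, ∃ B,
      Blk p q (univ.erase x) B ∧ 3 ≤ #B ∧ Wide P S p B ∧ NoCorner p q x B ∧
      Itv p (insert x B) univ ∧ Itv q (insert x B) univ := by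
    by_contra! hno
    have step : ∀ x ∉ S, ∃ p ∈ P, ∃ B, ∃ z ∈ S, Blk p q (univ.erase x) B ∧ 3 ≤ #B ∧ z ∈ B ∧
        ∃ y ∉ S, Blk p q (univ.erase x) (B.erase z) ∧
          ∀ p' ∈ P, ∀ c d, Bond p' q (univ.erase y) c d → c = z ∨ d = z := by
      intro x hx
      obtain ⟨p, hp, B, hB, h3, hw, hkey⟩ := exists_largest_blk hP hq hrec hx (hlarge x hx)
      rcases itv_insert_or_removable hP hq hN hp hB h3 hw hkey with h | ⟨z, hz, y, hy, hyz, h1, h2, h4⟩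
      · exact absurd h.2 (hno x hx p hp B hB h3 hw hkey h.1)
      · have hzS : z ∈ S := by
          by_contra hzS
          exact herase z hzS _ rfl hcard2 h2
        refine ⟨p, hp, B, z, hzS, hB, h3, hz, y, fun hyS => hyz ?_, h1, h4⟩
        exact card_le_one.1 (hB.card_inter_le hP hq hp hS (hsub x hx)) y (mem_inter.2 ⟨hyS, hy⟩) z
          (mem_inter.2 ⟨hzS, hz⟩)
    obtain ⟨-, -, -, z, hzS, -, -, -, y, hy, -, hbond⟩ := step x₀ hx₀
    obtain ⟨p, hp, B, z', hz'S, hB, h3, hz', -, -, hBz, -⟩ := step y hy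
    -- Every bond of `univ.erase y` uses `z`, so `z ∈ B`; as the only point of `S` in `B` it equals
    -- `z'`. But `B.erase z` is a block with two points, and its bond avoids `z`.
    have hzB : z ∈ B := by
      obtain ⟨a, b, hab⟩ := exists_bond (hP.1 p hp) hq B hB.2.2.2 (by omega)
      rcases hbond p hp a b (hab.of_itv hB.1 hB.2.1 hB.2.2.1) with rfl | rfl
      exacts [hab.1, hab.2.1]
    have hzz : z = z' := card_le_one.1 (hB.card_inter_le hP hq hp hS (hsub y hy)) z
      (mem_inter.2 ⟨hzS, hzB⟩) z' (mem_inter.2 ⟨hz'S, hz'⟩)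
    subst hzz
    have hc : #(B.erase z) = #B - 1 := card_erase_of_mem hzB
    obtain ⟨a, b, hab⟩ := exists_bond (hP.1 p hp) hq _ hBz.2.2.2 (by omega)
    rcases hbond p hp a b (hab.of_itv hBz.1 hBz.2.1 hBz.2.2.1) with rfl | rfl
    · exact ne_of_mem_erase hab.1 rfl
    · exact ne_of_mem_erase hab.2.1 rfl
  have hxB : x ∉ B := fun h => by simpa using hB.1 h
  have hp1 := hP.1 p hp
  have hwJ : Wide P S p (insert x B) := by
    rcases hw with hw | ⟨a, ha, b, hb, hab⟩
    · exact Or.inl hw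
    refine Or.inr ⟨a, ha, b, hb, ?_⟩
    have hax : a ≠ x := fun h => hx (h ▸ ha)
    have hbx : b ≠ x := fun h => hx (h ▸ hb)
    have haB : a ∉ B := fun h => lt_irrefl _ (hab a h).1
    have hbB : b ∉ B := fun h => lt_irrefl _ (hab b h).2
    obtain ⟨u, hu⟩ := card_pos.1 (by omega : 0 < #B)
    have h1 := hab u hu
    have h2 : p a ≠ p x := fun h => hax (hp1 h)
    have h3 : p b ≠ p x := fun h => hbx (hp1 h)
    intro c hc
    rcases mem_insert.1 hc with rfl | hc
    · constructor
      · by_contra h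
        have := hJp c (by simp) u (by simp [hu]) a (by simp) (by omega) h1.1
        simp [hax, haB] at this
      · by_contra h
        have := hJp u (by simp [hu]) c (by simp) b (by simp) h1.2 (by omega)
        simp [hbx, hbB] at this
    · exact hab c hc
  have hkeyJ : ∀ c, c ∉ insert x B → ∀ d ∈ insert x B, ∃ e, e ∉ insert x B ∧
      (IsBetween p c e d ∨ IsBetween q c e d) := by
    intro c hc d hd
    obtain ⟨u, hu⟩ := card_pos.1 (by omega : 0 < #B)
    obtain ⟨e, he, hex, h⟩ := hkey c (fun h => hc (by simp [h])) (fun h => hc (by simp [h])) u hu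
    have heJ : e ∉ insert x B := by simp [he, hex]
    refine ⟨e, heJ, ?_⟩
    have key : ∀ {f}, Function.Injective f → Itv f (insert x B) univ → IsBetween f c e u →
        IsBetween f c e d := by
      intro f hf hJ h
      have h1 := hJ.out hf (mem_univ c) hc
      have h2 := hJ.out hf (mem_univ e) heJ
      have hu' : u ∈ insert x B := by simp [hu]
      unfold IsBetween at *
      rcases h1 with h1 | h1 <;> rcases h2 with h2 | h2 <;>
        have := h1 u hu' <;> have := h2 u hu' <;> have := h1 d hd <;> have := h2 d hd <;> omega
    exact h.imp (key hp1 hJp) (key hq hJq)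
  have hrep : ∀ Q ⊆ insert x B, Q.Nonempty → KingOn p q Q → KingFor P q (univ \ insert x B ∪ Q) :=
    fun Q hQJ hQ hQk => KingFor.replace hP hq hp hN hwJ hJp hJq hkeyJ hQ hQJ hQk
  have hsingle : ∀ u : ι, KingOn p q {u} := fun u a b hab =>
    hab.2.2.1 ((mem_singleton.1 hab.1).trans (mem_singleton.1 hab.2.1).symm)
  have hcJ : ∀ u ∈ insert x B, #(univ \ insert x B ∪ {u}) = Fintype.card ι - #B := by
    intro u hu
    rw [card_union_of_disjoint (disjoint_singleton_right.2 fun h => (mem_sdiff.1 h).2 hu), card_sdiff_of_subset (subset_univ _),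
      card_insert_of_notMem hxB, card_singleton, card_univ]
    have : #(insert x B) ≤ Fintype.card ι := card_le_univ _
    rw [card_insert_of_notMem hxB] at this
    omega
  have hinter := hB.card_inter_le hP hq hp hS (hsub x hx)
  have hSJ : ∃ s ∈ S, s ∈ B := by
    -- Otherwise `J` could be shrunk to one point of `B`, giving a king set properly containing `S`.
    by_contra! hno
    have hSsub : S ⊆ univ \ insert x B := fun s hs => by
      have : s ≠ x := fun h => hx (h ▸ hs)
      simp [this, hno s hs]
    obtain ⟨u, hu⟩ := card_pos.1 (by omega : 0 < #B)
    have h1 := hcJ u (by simp [hu])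
    refine hmid _ (hSsub.trans subset_union_left) (hrep {u} (by simp [hu]) (by simp) (hsingle u)) ?_ ?_
    · have := card_le_card hSsub
      rw [card_union_of_disjoint (by simp [hu])]
      simp
      omega
    · omega
  obtain ⟨s, hs, hsB⟩ := hSJ
  have hsubS : S ⊆ univ \ insert x B ∪ {s} := by
    intro t ht
    by_cases htB : t ∈ B
    · have := card_le_one.1 hinter t (mem_inter.2 ⟨ht, htB⟩) s (mem_inter.2 ⟨hs, hsB⟩)
      simp [this]
    · have : t ≠ x := fun h => hx (h ▸ ht)
      simp [this, htB]
  refine ⟨p, hp, insert x B, s, hs, hJp, hJq, by simp [hsB], ?_, hrep⟩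
  by_contra hne
  refine hmid _ hsubS (hrep {s} (by simp [hsB]) (by simp) (hsingle s)) (card_lt_card ?_) ?_
  · exact ssubset_of_subset_of_ne hsubS (Ne.symm hne)
  · rw [hcJ s (by simp [hsB])]; omega
end KingPoset

/-! ### Twins, contraction of bonds, and the three-bond argument. -/

namespace KingPoset

open Finset

variable {ι : Type*} [DecidableEq ι]
variable {p p' q f g : ι → ℤ} {B C J Q S T U V W : Finset ι} {P : Set (ι → ℤ)}

lemma lt_iff_of_not_btw {a b c : ι} (hf : Function.Injective f) (ha : c ≠ a) (hb : c ≠ b)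
    (h : ¬ IsBetween f a c b) : (f a < f c ↔ f b < f c) ∧ (f c < f a ↔ f c < f b) := by
  have : f c ≠ f a := fun h => ha (hf h)
  have : f c ≠ f b := fun h => hb (hf h)
  unfold IsBetween at h
  omega

/-- In a copy of `2413` or `3142` a point can be replaced by a neighbour. -/
lemma Quad.replace {a b : ι} (hp : Function.Injective p) (hq : Function.Injective q) (hab : a ≠ b)
    {w₁ w₂ w₃ w₄ : ι} (h : Quad p q w₁ w₂ w₃ w₄)
    (h' : ∀ c, c = w₁ ∨ c = w₂ ∨ c = w₃ ∨ c = w₄ → ¬ IsBetween p a c b ∧ ¬ IsBetween q a c b) :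
    Quad p q (if w₁ = a then b else w₁) (if w₂ = a then b else w₂) (if w₃ = a then b else w₃)
      (if w₄ = a then b else w₄) := by
  have key : ∀ c, c = w₁ ∨ c = w₂ ∨ c = w₃ ∨ c = w₄ → c ≠ a → c ≠ b →
      ((p a < p c ↔ p b < p c) ∧ (p c < p a ↔ p c < p b)) ∧
      ((q a < q c ↔ q b < q c) ∧ (q c < q a ↔ q c < q b)) := fun c hc h1 h2 =>
    ⟨lt_iff_of_not_btw hp h1 h2 (h' c hc).1, lt_iff_of_not_btw hq h1 h2 (h' c hc).2⟩
  have n1 := h' w₁ (by simp)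
  have n2 := h' w₂ (by simp)
  have n3 := h' w₃ (by simp)
  have n4 := h' w₄ (by simp)
  have k1 := key w₁ (by simp)
  have k2 := key w₂ (by simp)
  have k3 := key w₃ (by simp)
  have k4 := key w₄ (by simp)
  obtain ⟨s12, s13, s14, s23, s24, s34⟩ := h.sep
  have ne : ∀ y z, p y < p z → z ≠ y := fun y z h => by rintro rfl; omega
  have e12 := ne _ _ h.1
  have e13 := ne _ _ (h.1.trans h.2.1)
  have e14 := ne _ _ (h.1.trans (h.2.1.trans h.2.2.1))
  have e23 := ne _ _ h.2.1
  have e24 := ne _ _ (h.2.1.trans h.2.2.1)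
  have e34 := ne _ _ h.2.2.1
  clear h' key ne
  by_cases a1 : w₁ = a
  · subst a1
    obtain ⟨⟨x2, y2⟩, u2, v2⟩ := k2 e12 (by rintro rfl; exact n4.2 s12)
    obtain ⟨⟨x3, y3⟩, u3, v3⟩ := k3 e13 (by rintro rfl; exact n2.1 s13)
    obtain ⟨⟨x4, y4⟩, u4, v4⟩ := k4 e14 (by rintro rfl; exact n3.1 s14)
    simp only [if_true, e12, e13, e14, if_false]
    unfold Quad at *
    simpa only [x2, y2, u2, v2, x3, y3, u3, v3, x4, y4, u4, v4] using h
  by_cases a2 : w₂ = a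
  · subst a2
    obtain ⟨⟨x1, y1⟩, u1, v1⟩ := k1 a1 (by rintro rfl; exact n4.2 s12.symm)
    obtain ⟨⟨x3, y3⟩, u3, v3⟩ := k3 e23 (by
      rintro rfl; exact s23.elim n1.2 n4.2)
    obtain ⟨⟨x4, y4⟩, u4, v4⟩ := k4 e24 (by rintro rfl; exact n3.1 s24)
    simp only [if_true, a1, e23, e24, if_false]
    unfold Quad at *
    simpa only [x1, y1, u1, v1, x3, y3, u3, v3, x4, y4, u4, v4] using h
  by_cases a3 : w₃ = a
  · subst a3
    obtain ⟨⟨x1, y1⟩, u1, v1⟩ := k1 a1 (by rintro rfl; exact n2.1 s13.symm)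
    obtain ⟨⟨x2, y2⟩, u2, v2⟩ := k2 a2 (by
      rintro rfl; exact s23.elim (fun h => n1.2 h.symm) (fun h => n4.2 h.symm))
    obtain ⟨⟨x4, y4⟩, u4, v4⟩ := k4 e34 (by rintro rfl; exact n1.2 s34)
    simp only [if_true, a1, a2, e34, if_false]
    unfold Quad at *
    simpa only [x1, y1, u1, v1, x2, y2, u2, v2, x4, y4, u4, v4] using h
  by_cases a4 : w₄ = a
  · subst a4
    obtain ⟨⟨x1, y1⟩, u1, v1⟩ := k1 a1 (by rintro rfl; exact n3.1 s14.symm)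
    obtain ⟨⟨x2, y2⟩, u2, v2⟩ := k2 a2 (by rintro rfl; exact n3.1 s24.symm)
    obtain ⟨⟨x3, y3⟩, u3, v3⟩ := k3 a3 (by rintro rfl; exact n1.2 s34.symm)
    simp only [if_true, a1, a2, a3, if_false]
    unfold Quad at *
    simpa only [x1, y1, u1, v1, x2, y2, u2, v2, x3, y3, u3, v3] using h
  simpa only [a1, a2, a3, a4, if_false] using h

/-- As 2413 and 3142 have no bonds, a copy uses at most one of two twins, and `a` can be traded for
`b`. -/
lemma QuadFree.insert_twin {a b : ι} (hp : Function.Injective p) (hq : Function.Injective q)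
    (hab : a ≠ b) (hC : QuadFree p q C) (hb : b ∈ C)
    (h : ∀ c ∈ insert a C, ¬ IsBetween p a c b ∧ ¬ IsBetween q a c b) : QuadFree p q (insert a C) := by
  intro w₁ h1 w₂ h2 w₃ h3 w₄ h4 hw
  have mem : ∀ w ∈ insert a C, (if w = a then b else w) ∈ C := by
    intro w hw
    split_ifs with h
    exacts [hb, (mem_insert.1 hw).resolve_left h]
  refine hC _ (mem _ h1) _ (mem _ h2) _ (mem _ h3) _ (mem _ h4) (hw.replace hp hq hab fun c hc => ?_)
  rcases hc with rfl | rfl | rfl | rfl <;> exact h _ ‹_›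

lemma Itv.insert_twin {a b : ι} (hf : Function.Injective f) (hC : Itv f C (T.erase a)) (hb : b ∈ C)
    (h : ∀ e ∈ T, ¬ IsBetween f a e b) : Itv f (insert a C) T := by
  have := hC.insert_of_no_btw (c := a) hb hf fun e he _ => h e (mem_of_mem_erase he)
  intro u hu v hv c hc huc hcv
  by_cases hca : c = a
  · simp [hca]
  · exact this u hu v hv c (by simp [hca, hc]) huc hcv

lemma Itv.of_erase {a b : ι} (hf : Function.Injective f) (hCT : C ⊆ T.erase a)
    (hC : Itv f C (T.erase a)) (hba : b ≠ a) (hbT : b ∈ T) (hb : b ∉ C)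
    (h : ∀ e ∈ T, ¬ IsBetween f a e b) : Itv f C T := by
  intro u hu v hv c hc huc hcv
  by_cases hca : c = a
  · subst hca
    exfalso
    have h1 := h u (mem_of_mem_erase (hCT hu))
    have h2 := h v (mem_of_mem_erase (hCT hv))
    have h3 : f u ≠ f b := fun h => hb (hf h ▸ hu)
    have h4 : f v ≠ f b := fun h => hb (hf h ▸ hv)
    unfold IsBetween at h1 h2
    exact hb (hC u hu v hv b (by simp [hba, hbT]) (by omega) (by omega))
  · exact hC u hu v hv c (by simp [hca, hc]) huc hcv

/-- Separable intervals lift along the contraction of a bond. -/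
lemma Blk.lift {a b : ι} (hP : IsFrame P) (hq : Function.Injective q) (hrec : Recuttable P q S)
    (hST : S ⊆ T) (haS : a ∉ S) (hp' : p' ∈ P) (hab : Bond p' q T a b)
    (h : ∃ p ∈ P, Blk p q (T.erase a) C) :
    ∃ D, (D = C ∨ D = insert a C) ∧ ∃ p ∈ P, Blk p q T D := by
  obtain ⟨p₀, hp₀, hC⟩ := h
  obtain ⟨p, hp, hC, hw⟩ := hrec _ C p₀ hp₀ (fun s hs => mem_erase.2
    ⟨by rintro rfl; exact haS hs, hST hs⟩) hC
  have hp1 := hP.1 p hp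
  obtain ⟨ha, hb, hne, hno⟩ := hab
  have hqno : ∀ e ∈ T, ¬ IsBetween q a e b := fun e he => (hno e he).2
  rcases Wide.compare hP hp hp' hw (sdiff_subset.trans hST) (fun e he => (hno e he).1) with h | ⟨-, h⟩
  · have hpno : ∀ e ∈ T, ¬ IsBetween p a e b := fun e he h' => (hno e he).1 ((h e).2 h')
    by_cases hbC : b ∈ C
    · refine ⟨insert a C, Or.inr rfl, p, hp, insert_subset ha (hC.1.trans (erase_subset _ _)),
        hC.2.1.insert_twin hp1 hbC hpno, hC.2.2.1.insert_twin hq hbC hqno,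
        hC.2.2.2.insert_twin hp1 hq hne hbC fun c hc => ?_⟩
      have : c ∈ T := by
        rcases mem_insert.1 hc with rfl | hc
        exacts [ha, mem_of_mem_erase (hC.1 hc)]
      exact ⟨hpno c this, hqno c this⟩
    · exact ⟨C, Or.inl rfl, p, hp, hC.1.trans (erase_subset _ _),
        hC.2.1.of_erase hp1 hC.1 hne.symm hb hbC hpno, hC.2.2.1.of_erase hq hC.1 hne.symm hb hbC hqno,
        hC.2.2.2⟩
  -- The bond goes around the cut, with `C` strictly between its ends for `p`, so `C` stays an
  -- interval when `a` returns.
  · have hbC : b ∉ C := fun hc => by have := h b hc; unfold IsBetween at this; omega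
    refine ⟨C, Or.inl rfl, p, hp, hC.1.trans (erase_subset _ _), ?_,
      hC.2.2.1.of_erase hq hC.1 hne.symm hb hbC hqno, hC.2.2.2⟩
    intro u hu v hv c hc huc hcv
    by_cases hca : c = a
    · subst hca
      have h1 := h u hu
      have h2 := h v hv
      unfold IsBetween at h1 h2
      omega
    · exact hC.2.1 u hu v hv c (by simp [hca, hc]) huc hcv

lemma Blk.pair {a b : ι} (h : Bond p q T a b) : Blk p q T {a, b} := by
  obtain ⟨ha, hb, hne, hno⟩ := h
  refine ⟨by simp [insert_subset_iff, ha, hb], ?_, ?_, ?_⟩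
  · intro u hu v hv c hc huc hcv
    have := (hno c hc).1
    simp only [mem_insert, mem_singleton] at hu hv
    unfold IsBetween at this
    rcases hu with rfl | rfl <;> rcases hv with rfl | rfl <;> omega
  · intro u hu v hv c hc huc hcv
    have := (hno c hc).2
    simp only [mem_insert, mem_singleton] at hu hv
    unfold IsBetween at this
    rcases hu with rfl | rfl <;> rcases hv with rfl | rfl <;> omega
  · intro u hu v hv w hw x hx h
    obtain ⟨h1, h2, -⟩ := h
    simp only [mem_insert, mem_singleton] at hu hv hw
    rcases hu with rfl | rfl <;> rcases hv with rfl | rfl <;> rcases hw with rfl | rfl <;> omega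

lemma Blk.bond_of_pair {a b : ι} (h : Blk p q T {a, b}) (hne : a ≠ b) : Bond p q T a b := by
  refine (bond_pair hne).of_itv h.1 h.2.1 h.2.2.1

/-- Neighbours of `x` on both sides are unique. -/
lemma eq_or_eq_of_isBetween {a b c d x : ι} (hf : Function.Injective f) (ha : a ∈ T)
    (hc : c ∈ T) (hd : d ∈ T) (hab : ∀ e ∈ T, ¬ IsBetween f a e b) (hcd : ∀ e ∈ T, ¬ IsBetween f c e d)
    (hxa : IsBetween f a x b) (hxc : IsBetween f c x d) : a = c ∨ a = d := by
  by_contra! h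
  have h1 : f a ≠ f c := fun h' => h.1 (hf h')
  have h2 : f a ≠ f d := fun h' => h.2 (hf h')
  have h3 := hab c hc
  have h4 := hab d hd
  have h5 := hcd a ha
  unfold IsBetween at *
  omega

variable [Fintype ι]

/-- A bond of the complement of `x` that is created by removing `x` between two positions is
determined by `x`. -/
lemma mem_pair_of_btw {a b c d x : ι} (hP : IsFrame P) (hxS : x ∉ S) (hp : p ∈ P) (hp' : p' ∈ P)
    (hw : Wide P S p {a, b}) (hab : Bond p q (univ.erase x) a b)
    (hcd : Bond p' q (univ.erase x) c d) (hx : IsBetween p a x b) (hx' : IsBetween p' c x d) :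
    a = c ∨ a = d := by
  have hsub : S \ {a, b} ⊆ univ.erase x := fun s hs => by
    have : s ≠ x := fun h => hxS (h ▸ (mem_sdiff.1 hs).1)
    simp [this]
  rcases Wide.compare hP hp hp' hw hsub (fun e he => (hcd.2.2.2 e he).1) with h | ⟨h, hJ⟩
  · exact eq_or_eq_of_isBetween (hP.1 p hp) hab.1 hcd.1 hcd.2.1 (fun e he => (hab.2.2.2 e he).1)
      (fun e he h' => (hcd.2.2.2 e he).1 ((h e).2 h')) hx ((h x).1 hx')
  · exfalso
    have h1 := hJ a (by simp)
    have h2 := hJ b (by simp)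
    refine (h x (ne_of_mem_erase hcd.1).symm (ne_of_mem_erase hcd.2.1).symm).1 hx' ?_
    unfold IsBetween at *
    omega

/-- The gap of 4 leaves room to find a bond after each of three deletions. The deleted endpoints `a`
and `c` avoid the later pairs, so separation by `x` in a common coordinate is contradictory. -/
lemma exists_large_blk {x : ι} (hP : IsFrame P) (hq : Function.Injective q)
    (hrec : Recuttable P q S) (hS : KingFor P q S) (hN : KingFor P q univ)
    (hcard : #S + 4 ≤ Fintype.card ι)
    (hmid : ∀ W, S ⊆ W → KingFor P q W → #S < #W → #W < Fintype.card ι → False) (hx : x ∉ S) :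
    ∃ p ∈ P, ∃ C, Blk p q (univ.erase x) C ∧ 3 ≤ #C := by
  by_contra! hno
  have exists_bond' : ∀ T, S ⊆ T → #S < #T → #T < Fintype.card ι →
      ∃ p ∈ P, ∃ a b, a ∉ S ∧ Bond p q T a b := by
    intro T hST h1 h2
    have h3 := fun hT => hmid T hST hT h1 h2
    obtain ⟨p, hp, a, b, hab⟩ : ∃ p ∈ P, ∃ a b, Bond p q T a b := by
      by_contra! h'
      exact h3 h'
    by_cases ha : a ∈ S
    · by_cases hb : b ∈ S
      · exact absurd ⟨ha, hb, hab.2.2.1, fun c hc => hab.2.2.2 c (hST hc)⟩ (hS p hp a b)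
      · exact ⟨p, hp, b, a, hb, hab.symm⟩
    · exact ⟨p, hp, a, b, ha, hab⟩
  have hT : #(univ.erase x) = Fintype.card ι - 1 := by simp
  have sub : ∀ {T : Finset ι} {a}, S ⊆ T → a ∉ S → S ⊆ T.erase a := fun h ha s hs =>
    mem_erase.2 ⟨fun h' => ha (h' ▸ hs), h hs⟩
  have hS0 := sub (subset_univ S) hx
  obtain ⟨p₁, hp₁, a, b, ha, hab⟩ := exists_bond' _ hS0 (by omega) (by omega)
  have hT1 := card_erase_of_mem hab.1
  have hS1 := sub hS0 ha
  obtain ⟨p₂, hp₂, c, d, hc, hcd⟩ := exists_bond' _ hS1 (by omega) (by omega)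
  have hT2 := card_erase_of_mem hcd.1
  obtain ⟨p₃, hp₃, e, f, he, hef⟩ := exists_bond' _ (sub hS1 hc) (by omega) (by omega)
  have small : ∀ a C, a ∉ C → 2 ≤ #C → ∀ p ∈ P, ¬ Blk p q (univ.erase x) (insert a C) := by
    intro a C haC hC p hp h
    have := hno p hp _ h
    rw [card_insert_of_notMem haC] at this
    omega
  have hcd' : ∃ p ∈ P, Blk p q (univ.erase x) {c, d} := by
    obtain ⟨D, rfl | rfl, p, hp, hD⟩ := Blk.lift hP hq hrec hS0 ha hp₁ hab ⟨p₂, hp₂, Blk.pair hcd⟩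
    · exact ⟨p, hp, hD⟩
    · refine absurd hD (small a _ ?_ (card_pair hcd.2.2.1).ge p hp)
      have h1 := ne_of_mem_erase hcd.1
      have h2 := ne_of_mem_erase hcd.2.1
      simp [h1.symm, h2.symm]
  have hef' : ∃ p ∈ P, Blk p q (univ.erase x) {e, f} := by
    have h1 := ne_of_mem_erase hef.1
    have h2 := ne_of_mem_erase hef.2.1
    have h3 := ne_of_mem_erase (mem_of_mem_erase hef.1)
    have h4 := ne_of_mem_erase (mem_of_mem_erase hef.2.1)
    obtain ⟨D, hD, hD'⟩ := Blk.lift hP hq hrec hS1 hc hp₂ hcd ⟨p₃, hp₃, Blk.pair hef⟩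
    obtain ⟨E, hE, p, hp, hE'⟩ := Blk.lift hP hq hrec hS0 ha hp₁ hab hD'
    have hcard : #({e, f} : Finset ι) = 2 := card_pair hef.2.2.1
    rcases hD with rfl | rfl
    · rcases hE with rfl | rfl
      · exact ⟨p, hp, hE'⟩
      · exact absurd hE' (small a _ (by simp [h3.symm, h4.symm]) hcard.ge p hp)
    · have hcef : c ∉ ({e, f} : Finset ι) := by simp [h1.symm, h2.symm]
      rcases hE with rfl | rfl
      · exact absurd hE' (small c _ hcef hcard.ge p hp)
      · have hac := (ne_of_mem_erase hcd.1).symm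
        refine absurd hE' (small a _ (by simp [h3.symm, h4.symm, hac]) ?_ p hp)
        rw [card_insert_of_notMem hcef]; omega
  have wide : ∀ a b, a ≠ b → (∃ p ∈ P, Blk p q (univ.erase x) {a, b}) →
      ∃ p ∈ P, Wide P S p {a, b} ∧ Bond p q (univ.erase x) a b ∧ (IsBetween p a x b ∨ IsBetween q a x b) := by
    rintro a b hab ⟨p, hp, h⟩
    obtain ⟨p', hp', h', hw⟩ := hrec _ _ p hp hS0 h
    have hb := h'.bond_of_pair hab
    exact ⟨p', hp', hw, hb, (hN p' hp').btw_of_bond_erase hb⟩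
  obtain ⟨r₁, hr₁, hw₁, hb₁, ht₁⟩ := wide a b hab.2.2.1 ⟨p₁, hp₁, Blk.pair hab⟩
  obtain ⟨r₂, hr₂, hw₂, hb₂, ht₂⟩ := wide c d hcd.2.2.1 hcd'
  obtain ⟨r₃, hr₃, hw₃, hb₃, ht₃⟩ := wide e f hef.2.2.1 hef'
  have hac := (ne_of_mem_erase hcd.1).symm
  have had := (ne_of_mem_erase hcd.2.1).symm
  have hce := (ne_of_mem_erase hef.1).symm
  have hcf := (ne_of_mem_erase hef.2.1).symm
  have hae := (ne_of_mem_erase (mem_of_mem_erase hef.1)).symm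
  have haf := (ne_of_mem_erase (mem_of_mem_erase hef.2.1)).symm
  have conc : ∀ {r r' : ι → ℤ} {a b c d : ι}, r ∈ P → r' ∈ P → Wide P S r {a, b} →
      Bond r q (univ.erase x) a b → Bond r' q (univ.erase x) c d → a ≠ c → a ≠ d →
      ¬ (IsBetween r a x b ∧ IsBetween r' c x d) ∧ ¬ (IsBetween q a x b ∧ IsBetween q c x d) := by
    intro r r' a b c d hr hr' hw h1 h2 hac had
    constructor
    · rintro ⟨h3, h4⟩
      rcases mem_pair_of_btw hP hx hr hr' hw h1 h2 h3 h4 with h | h <;> contradiction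
    · rintro ⟨h3, h4⟩
      rcases eq_or_eq_of_isBetween hq h1.1 h2.1 h2.2.1 (fun e he => (h1.2.2.2 e he).2)
        (fun e he => (h2.2.2.2 e he).2) h3 h4 with h | h <;> contradiction
  have c1 := conc hr₁ hr₂ hw₁ hb₁ hb₂ hac had
  have c2 := conc hr₁ hr₃ hw₁ hb₁ hb₃ hae haf
  have c3 := conc hr₂ hr₃ hw₂ hb₂ hb₃ hce hcf
  clear * - c1 c2 c3 ht₁ ht₂ ht₃
  -- Pigeonhole: three pairs, but only position and value to separate them.
  rcases ht₁ with h1 | h1 <;> rcases ht₂ with h2 | h2 <;> rcases ht₃ with h3 | h3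
  exacts [c1.1 ⟨h1, h2⟩, c1.1 ⟨h1, h2⟩, c2.1 ⟨h1, h3⟩, c3.2 ⟨h2, h3⟩, c3.1 ⟨h2, h3⟩, c2.2 ⟨h1, h3⟩,
    c1.2 ⟨h1, h2⟩, c1.2 ⟨h1, h2⟩]
end KingPoset

/-! ### Small king subsets, and the bound for the linear case. -/

namespace KingPoset

open Finset

variable {ι : Type*} [DecidableEq ι]
variable {p p' q f g : ι → ℤ} {B C J Q S T U V W : Finset ι} {P : Set (ι → ℤ)}

lemma Quad.kingOn {a b c d : ι} (h : Quad p q a b c d) : KingOn p q {a, b, c, d} := by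
  intro u v huv
  obtain ⟨hu, hv, hne, hno⟩ := huv
  have na := hno a (by simp)
  have nb := hno b (by simp)
  have nc := hno c (by simp)
  have nd := hno d (by simp)
  obtain ⟨h1, h2, h3, h4⟩ := h
  clear hno
  simp only [mem_insert, mem_singleton] at hu hv
  unfold IsBetween at *
  rcases hu with rfl | rfl | rfl | rfl <;> rcases hv with rfl | rfl | rfl | rfl <;>
    first | exact hne rfl | omega

lemma Quad.one_lt_card {a b c d : ι} (h : Quad p q a b c d) : 1 < #({a, b, c, d} : Finset ι) :=
  Finset.one_lt_card.2 ⟨a, by simp, b, by simp, by rintro rfl; exact lt_irrefl _ h.1⟩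

lemma KingOn.exists_quad (hp : Function.Injective p) (hq : Function.Injective q)
    (h : KingOn p q J) (hJ : 2 ≤ #J) :
    ∃ a b c d, ({a, b, c, d} : Finset ι) ⊆ J ∧ Quad p q a b c d := by
  by_contra! hno
  obtain ⟨a, b, hab⟩ := exists_bond hp hq J (fun a ha b hb c hc d hd hQ =>
    hno a b c d (by simp [insert_subset_iff, ha, hb, hc, hd]) hQ) hJ
  exact h a b hab

/-- Every element of a king set lies in a king subset with between two and five elements. -/
lemma KingOn.exists_small {s : ι} (hp : Function.Injective p) (hq : Function.Injective q)
    (h : KingOn p q J) (hJ : 2 ≤ #J) (hs : s ∈ J) :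
    ∃ Q ⊆ J, s ∈ Q ∧ KingOn p q Q ∧ 1 < #Q ∧ #Q ≤ 5 := by
  obtain ⟨a, b, c, d, hsub, hQ⟩ := h.exists_quad hp hq hJ
  by_cases hsQ : s ∈ ({a, b, c, d} : Finset ι)
  · exact ⟨_, hsub, hsQ, hQ.kingOn, hQ.one_lt_card, card_le_four.trans (by norm_num)⟩
  by_cases hk : KingOn p q (insert s {a, b, c, d})
  · refine ⟨_, insert_subset hs hsub, mem_insert_self _ _, hk,
      hQ.one_lt_card.trans_le (card_le_card (subset_insert _ _)), card_le_five⟩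
  obtain ⟨u, v, huv⟩ : ∃ u v, Bond p q (insert s {a, b, c, d}) u v := by
    by_contra! h'
    exact hk h'
  -- The four points are king, so the bond involves `s`; its other end `t` is a twin and can be
  -- replaced by `s`.
  obtain ⟨t, ht, hts⟩ : ∃ t ∈ ({a, b, c, d} : Finset ι),
      ∀ e ∈ insert s ({a, b, c, d} : Finset ι), ¬ IsBetween p t e s ∧ ¬ IsBetween q t e s := by
    by_cases hus : u = s
    · subst hus
      exact ⟨v, (mem_insert.1 huv.2.1).resolve_left huv.2.2.1.symm, huv.symm.2.2.2⟩
    by_cases hvs : v = s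
    · subst hvs
      exact ⟨u, (mem_insert.1 huv.1).resolve_left huv.2.2.1, huv.2.2.2⟩
    exact absurd ⟨(mem_insert.1 huv.1).resolve_left hus, (mem_insert.1 huv.2.1).resolve_left hvs,
      huv.2.2.1, fun c hc => huv.2.2.2 c (mem_insert_of_mem hc)⟩ (hQ.kingOn u v)
  have hst : t ≠ s := fun h => hsQ (h ▸ ht)
  have hQ' := hQ.replace hp hq hst fun c hc => hts c (by simp; tauto)
  refine ⟨_, ?_, ?_, hQ'.kingOn, hQ'.one_lt_card, card_le_four.trans (by norm_num)⟩
  · have mem : ∀ w ∈ ({a, b, c, d} : Finset ι), (if w = t then s else w) ∈ J := by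
      intro w hw
      split_ifs
      exacts [hs, hsub hw]
    simp [insert_subset_iff, mem]
  · simp only [mem_insert, mem_singleton] at ht ⊢
    rcases ht with rfl | rfl | rfl | rfl <;> simp

lemma isFrame_singleton (hp : Function.Injective p) : IsFrame {p} := by
  refine ⟨by simpa using hp, ?_⟩
  rintro _ rfl _ rfl c d
  exact Or.inl fun e => Iff.rfl

lemma recuttable_singleton : Recuttable {p} q S := by
  rintro T C _ rfl - h
  exact ⟨_, rfl, h, Or.inl fun _ h => h⟩

lemma kingFor_singleton : KingFor {p} q W ↔ KingOn p q W := by simp [KingFor]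

/-- A king set with at least four elements more than a king subset `S` has a smaller king subset
that contains a larger set that contains a copy of `S`. -/
lemma exists_between [Fintype ι] (hp : Function.Injective p) (hq : Function.Injective q)
    (hS : KingOn p q S) (hN : KingOn p q univ) (hcard : #S + 4 ≤ Fintype.card ι) :
    ∃ W, KingOn p q W ∧ #S < #W ∧ #W < Fintype.card ι ∧ ∃ r : ι → ι, (∀ s ∈ S, r s ∈ W) ∧
      ∀ s ∈ S, ∀ t ∈ S, (p s < p t → p (r s) < p (r t)) ∧ (q s < q t ↔ q (r s) < q (r t)) := by
  by_contra! hno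
  have hmid : ∀ W, S ⊆ W → KingFor {p} q W → #S < #W → #W < Fintype.card ι → False := by
    intro W hSW hW h1 h2
    obtain ⟨s, hs, t, ht, h⟩ := hno W (kingFor_singleton.1 hW) h1 h2 id hSW
    have := h id
    simp only [id] at this
    omega
  have hP := isFrame_singleton hp
  have hS' := (kingFor_singleton (q := q)).2 hS
  have hN' := (kingFor_singleton (q := q)).2 hN
  obtain ⟨p', hp', J, s, hs, hJp, hJq, hsJ, hSJ, hrep⟩ := exists_interval hP hq
    recuttable_singleton hS' hN' (by omega) hmid
    (fun x hx => exists_large_blk hP hq recuttable_singleton hS' hN' hcard hmid hx)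
  rw [Set.mem_singleton_iff] at hp'
  subst hp'
  have hJk : KingOn p' q J := fun a b hab => hN a b (hab.of_itv (subset_univ _) hJp hJq)
  have hdisj : ∀ Q ⊆ J, #(univ \ J ∪ Q) = Fintype.card ι - #J + #Q := by
    intro Q hQ
    rw [card_union_of_disjoint (disjoint_sdiff_self_left.mono_right hQ),
      card_sdiff_of_subset (subset_univ _), card_univ]
  have hJle : #J ≤ Fintype.card ι := card_le_univ _
  have hScard := hdisj {s} (by simpa using hsJ)
  rw [hSJ, card_singleton] at hScard
  obtain ⟨a, b, c, d, hsub, hQ⟩ := hJk.exists_quad hp hq (by omega)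
  have h1 := hQ.one_lt_card
  have h4 : #({a, b, c, d} : Finset ι) ≤ 4 := card_le_four
  have hW := hdisj _ hsub
  have haJ : a ∈ J := hsub (by simp)
  -- The copy of `S` has `s` moved to `a`; as `J` is an interval, both compare alike with every
  -- point outside it.
  obtain ⟨u, hu, v, hv, h⟩ := hno _ (kingFor_singleton.1 (hrep _ hsub ⟨a, by simp⟩ hQ.kingOn))
    (by omega) (by omega) (fun t => if t = s then a else t) (by
      intro t ht
      rw [← hSJ] at ht
      by_cases hts : t = s
      · simp [hts]
      · simp only [hts, if_false]
        refine mem_union_left _ ((mem_union.1 ht).resolve_right (by simpa using hts)))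
  have out : ∀ t ∈ S, t ≠ s → t ∉ J := by
    intro t ht hts
    rw [← hSJ] at ht
    simpa [hts] using ht
  by_cases hus : u = s <;> by_cases hvs : v = s
  · subst hus; subst hvs
    have := h (fun h => absurd h (lt_irrefl _))
    omega
  · subst hus
    simp only [if_true, hvs, if_false] at h
    have h1 := hJp.out hp (mem_univ _) (out v hv hvs)
    have h2 := hJq.out hq (mem_univ _) (out v hv hvs)
    have h3 : (p' u < p' v → p' a < p' v) ∧ (q u < q v ↔ q a < q v) := by
      rcases h1 with h1 | h1 <;> rcases h2 with h2 | h2 <;> have := h1 _ hsJ <;>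
        have := h1 _ haJ <;> have := h2 _ hsJ <;> have := h2 _ haJ <;> omega
    have := h h3.1
    omega
  · subst hvs
    simp only [if_true, hus, if_false] at h
    have h1 := hJp.out hp (mem_univ _) (out u hu hus)
    have h2 := hJq.out hq (mem_univ _) (out u hu hus)
    have h3 : (p' u < p' v → p' u < p' a) ∧ (q u < q v ↔ q u < q a) := by
      rcases h1 with h1 | h1 <;> rcases h2 with h2 | h2 <;> have := h1 _ hsJ <;>
        have := h1 _ haJ <;> have := h2 _ hsJ <;> have := h2 _ haJ <;> omega
    have := h h3.1
    omega
  · simp only [hus, hvs, if_false] at h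
    have := h id
    omega

/-! ### Rotations, and the bound for the cylindrical case. -/

/-- The points `a`, `b`, `c` appear in this cyclic order. -/
def Cyc (f : ι → ℤ) (a b c : ι) : Prop :=
  (f a < f b ∧ f b < f c) ∨ (f b < f c ∧ f c < f a) ∨ (f c < f a ∧ f a < f b)

/-- The injective position functions with the same cyclic order as `p`. -/
def rotations (p : ι → ℤ) : Set (ι → ℤ) :=
  {p' | Function.Injective p' ∧ ∀ a b c, Cyc p a b c ↔ Cyc p' a b c}

/-- The cyclic order determines both arcs cut out by `c` and `d`; which one is "between" depends
only on which of the two comes first. -/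
lemma isFrame_rotations : IsFrame (rotations p) := by
  refine ⟨fun p' h => h.1, ?_⟩
  rintro r ⟨hr, h⟩ r' ⟨hr', h'⟩ c d
  have hrr : ∀ a b c, Cyc r a b c ↔ Cyc r' a b c := fun a b c => (h a b c).symm.trans (h' a b c)
  by_cases hcd : c = d
  · subst hcd
    left
    intro e
    unfold IsBetween
    omega
  have n1 : r c ≠ r d := fun h => hcd (hr h)
  have n2 : r' c ≠ r' d := fun h => hcd (hr' h)
  by_cases hlt : r c < r d ↔ r' c < r' d
  · left
    intro e
    have h1 := hrr c e d
    have h2 := hrr d e c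
    unfold IsBetween
    unfold Cyc at h1 h2
    omega
  · right
    intro e hec hed
    have h1 := hrr c e d
    have h2 := hrr d e c
    have : r e ≠ r c := fun h => hec (hr h)
    have : r e ≠ r d := fun h => hed (hr h)
    have : r' e ≠ r' c := fun h => hec (hr' h)
    have : r' e ≠ r' d := fun h => hed (hr' h)
    unfold IsBetween
    unfold Cyc at h1 h2
    omega

/-- The positions below `k` can be moved beyond all the others. -/
lemma exists_rotation [Fintype ι] (hp : p' ∈ rotations p) (k : ℤ) :
    ∃ r ∈ rotations p, ∃ M : ℤ, (∀ i j, p' i < p' j + M) ∧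
      ∀ i, r i = if p' i < k then p' i + M else p' i := by
  obtain ⟨A, hA⟩ := (univ.image p').exists_le
  obtain ⟨B, hB⟩ := (univ.image (-p')).exists_le
  have hA' : ∀ i, p' i ≤ A := fun i => hA _ (by simp)
  have hB' : ∀ i, - p' i ≤ B := fun i => hB _ (by simp)
  have hM : ∀ i j, p' i < p' j + (A + B + 1) := fun i j => by
    have := hA' i; have := hB' j; omega
  refine ⟨fun i => if p' i < k then p' i + (A + B + 1) else p' i, ⟨?_, ?_⟩, A + B + 1, hM,
    fun i => rfl⟩
  · intro i j hij
    apply hp.1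
    have := hM i j
    have := hM j i
    simp only at hij
    split_ifs at hij <;> omega
  · intro a b c
    rw [hp.2 a b c]
    have := hM a b
    have := hM b a
    have := hM a c
    have := hM c a
    have := hM b c
    have := hM c b
    unfold Cyc
    simp only
    split_ifs <;> omega

lemma Blk.rotate [Fintype ι] {r : ι → ℤ} {k M : ℤ} (h : Blk p' q T C)
    (hM : ∀ i j, p' i < p' j + M) (hr : ∀ i, r i = if p' i < k then p' i + M else p' i)
    (hk : (∀ c ∈ C, p' c < k) ∨ ∀ c ∈ C, k ≤ p' c) : Blk r q T C := by
  obtain ⟨h1, h2, h3, h4⟩ := h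
  refine ⟨h1, ?_, h3, ?_⟩
  · intro a ha b hb c hc hac hcb
    rw [hr a, hr c] at hac
    rw [hr b, hr c] at hcb
    have := hM a c
    have := hM c b
    have := hM c a
    have := hM b c
    refine h2 a ha b hb c hc ?_ ?_ <;>
    rcases hk with hk | hk <;> have := hk a ha <;> have := hk b hb <;>
      split_ifs at hac hcb <;> omega
  · have key : ∀ a ∈ C, ∀ b ∈ C, r a < r b → p' a < p' b := by
      intro a ha b hb hab
      rw [hr a, hr b] at hab
      rcases hk with hk | hk <;> have := hk a ha <;> have := hk b hb <;>
        split_ifs at hab <;> omega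
    rintro a ha b hb c hc d hd ⟨x1, x2, x3, x4⟩
    exact h4 a ha b hb c hc d hd ⟨key _ ha _ hb x1, key _ hb _ hc x2, key _ hc _ hd x3, x4⟩

/-- `S` has three points and at most one in `C`, so two are outside; cutting just before the later
one, if necessary, makes them enclose `C`. -/
lemma recuttable_rotations [Fintype ι] (hq : Function.Injective q)
    (hS : KingFor (rotations p) q S) (h3 : 3 ≤ #S) : Recuttable (rotations p) q S := by
  intro T C p' hp' hST hC
  have h1 := hC.card_inter_le isFrame_rotations hq hp' hS hST
  have h2 : 1 < #(S \ C) := by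
    have := card_sdiff_add_card_inter S C
    omega
  obtain ⟨a, ha, b, hb, hne⟩ := Finset.one_lt_card.1 h2
  rw [mem_sdiff] at ha hb
  have hab : p' a ≠ p' b := fun h => hne (hp'.1 h)
  clear h2
  wlog hlt : p' a < p' b generalizing a b
  · exact this b hb a ha hne.symm hab.symm (by omega)
  have oa := hC.2.1.out hp'.1 (hST ha.1) ha.2
  have ob := hC.2.1.out hp'.1 (hST hb.1) hb.2
  rcases oa with oa | oa <;> rcases ob with ob | ob
  · obtain ⟨r, hr, M, hM, hr'⟩ := exists_rotation hp' (p' b)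
    refine ⟨r, hr, hC.rotate hM hr' (Or.inr fun c hc => (ob c hc).le),
      Or.inr ⟨b, hb.1, a, ha.1, fun c hc => ?_⟩⟩
    have := ob c hc
    have := hM c a
    rw [hr' a, hr' b, hr' c]
    split_ifs <;> omega
  · exact ⟨p', hp', hC, Or.inr ⟨a, ha.1, b, hb.1, fun c hc => ⟨oa c hc, ob c hc⟩⟩⟩
  · exact ⟨p', hp', hC, Or.inr ⟨b, hb.1, a, ha.1, fun c hc => by
      have := oa c hc; have := ob c hc; omega⟩⟩
  · obtain ⟨r, hr, M, hM, hr'⟩ := exists_rotation hp' (p' b)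
    refine ⟨r, hr, hC.rotate hM hr' (Or.inl ob),
      Or.inr ⟨b, hb.1, a, ha.1, fun c hc => ?_⟩⟩
    have := ob c hc
    have := oa c hc
    have := hM b c
    rw [hr' a, hr' b, hr' c]
    split_ifs <;> omega

/-- A cylindrical king set with at least five elements more than a cylindrical king subset has a
smaller cylindrical king subset that is larger than the latter. -/
lemma exists_between_rotations [Fintype ι] (hq : Function.Injective q)
    (hS : KingFor (rotations p) q S) (h3 : 3 ≤ #S) (hN : KingFor (rotations p) q univ)
    (hcard : #S + 5 ≤ Fintype.card ι) :
    ∃ W, S ⊆ W ∧ KingFor (rotations p) q W ∧ #S < #W ∧ #W < Fintype.card ι := by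
  by_contra! hno
  have hmid : ∀ W, S ⊆ W → KingFor (rotations p) q W → #S < #W → #W < Fintype.card ι → False :=
    fun W h1 h2 h3 h4 => absurd (hno W h1 h2 h3) (by omega)
  have hP := isFrame_rotations (p := p)
  have hrec := recuttable_rotations hq hS h3
  obtain ⟨p', hp', J, s, hs, hJp, hJq, hsJ, hSJ, hrep⟩ := exists_interval hP hq
    hrec hS hN (by omega) hmid
    (fun x hx => exists_large_blk hP hq hrec hS hN (by omega) hmid hx)
  have hJk : KingOn p' q J := fun a b hab => hN p' hp' a b (hab.of_itv (subset_univ _) hJp hJq)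
  have hdisj : ∀ Q ⊆ J, #(univ \ J ∪ Q) = Fintype.card ι - #J + #Q := by
    intro Q hQ
    rw [card_union_of_disjoint (disjoint_sdiff_self_left.mono_right hQ),
      card_sdiff_of_subset (subset_univ _), card_univ]
  have hJle : #J ≤ Fintype.card ι := card_le_univ _
  have hScard := hdisj {s} (by simpa using hsJ)
  rw [hSJ, card_singleton] at hScard
  -- `J` may straddle the cut of `p`, so `s` has to be kept; this can cost a fifth point.
  obtain ⟨Q, hQJ, hsQ, hQ, hQ1, hQ5⟩ := hJk.exists_small (hP.1 p' hp') hq (by omega) hsJ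
  have hW := hdisj Q hQJ
  refine hmid _ ?_ (hrep Q hQJ ⟨s, hsQ⟩ hQ) (by omega) (by omega)
  rw [← hSJ]
  exact union_subset_union_right (by simpa using hsQ)

/-- The extreme values of the quad are at `b` and `c`, so the pattern is 52413 or 53142, both
cylindrical kings. -/
lemma Quad.kingFor_insert {a b c d m : ι} (hp' : p' ∈ rotations p) (h : Quad p' q a b c d)
    (hm : p' m < p' a) (hmb : q b < q m) (hmc : q c < q m) :
    KingFor (rotations p) q {m, a, b, c, d} := by
  intro r hr u v huv
  obtain ⟨hu, hv, hne, hno⟩ := huv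
  have hcomp : (∀ e ∈ ({m, a, b, c, d} : Finset ι), ¬ IsBetween p' u e v) ∨
      ∀ e ∈ ({m, a, b, c, d} : Finset ι), p' e ≠ p' u → p' e ≠ p' v → IsBetween p' u e v := by
    rcases isFrame_rotations.2 p' hp' r hr u v with h | h
    · exact Or.inl fun e he h' => (hno e he).1 ((h e).2 h')
    · refine Or.inr fun e he h1 h2 => ?_
      by_contra h3
      exact (hno e he).1 ((h e (fun h => h1 (h ▸ rfl)) (fun h => h2 (h ▸ rfl))).2 h3)
  have nm := (hno m (by simp)).2
  have na := (hno a (by simp)).2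
  have nb := (hno b (by simp)).2
  have nc := (hno c (by simp)).2
  have nd := (hno d (by simp)).2
  have huv' : p' u ≠ p' v := fun h => hne (hp'.1 h)
  obtain ⟨h1, h2, h3, h4⟩ := h
  have hc : (¬ IsBetween p' u m v ∧ ¬ IsBetween p' u a v ∧ ¬ IsBetween p' u b v ∧ ¬ IsBetween p' u c v ∧ ¬ IsBetween p' u d v) ∨
      ((p' m ≠ p' u → p' m ≠ p' v → IsBetween p' u m v) ∧ (p' a ≠ p' u → p' a ≠ p' v → IsBetween p' u a v) ∧
       (p' b ≠ p' u → p' b ≠ p' v → IsBetween p' u b v) ∧ (p' c ≠ p' u → p' c ≠ p' v → IsBetween p' u c v) ∧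
       (p' d ≠ p' u → p' d ≠ p' v → IsBetween p' u d v)) := by
    rcases hcomp with h | h
    · exact Or.inl ⟨h _ (by simp), h _ (by simp), h _ (by simp), h _ (by simp), h _ (by simp)⟩
    · exact Or.inr ⟨h _ (by simp), h _ (by simp), h _ (by simp), h _ (by simp), h _ (by simp)⟩
  clear hcomp hno
  simp only [mem_insert, mem_singleton] at hu hv
  unfold IsBetween at *
  rcases hc with hc | hc <;>
  rcases hu with rfl | rfl | rfl | rfl | rfl <;> rcases hv with rfl | rfl | rfl | rfl | rfl <;>
    first | exact hne rfl | omega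

/-- A cylindrical king set with at least two elements contains one with five elements. -/
lemma exists_card_eq_five [Fintype ι] (hp : Function.Injective p) (hq : Function.Injective q)
    (hS : KingFor (rotations p) q S) (h2 : 2 ≤ #S) :
    ∃ R ⊆ S, KingFor (rotations p) q R ∧ #R = 5 := by
  have hpp : p ∈ rotations p := ⟨hp, fun _ _ _ => Iff.rfl⟩
  obtain ⟨m, hm, hmax⟩ := S.exists_max_image q (card_pos.1 (by omega))
  obtain ⟨r, hr, M, hM, hr'⟩ := exists_rotation hpp (p m)
  have hrm : ∀ i ∈ S.erase m, r m < r i := by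
    intro i hi
    have : p i ≠ p m := fun h => ne_of_mem_erase hi (hp h)
    have := hM m i
    rw [hr' m, hr' i]
    split_ifs <;> omega
  have hqm : ∀ i ∈ S.erase m, q i < q m := fun i hi =>
    lt_of_le_of_ne (hmax i (mem_of_mem_erase hi)) fun h => ne_of_mem_erase hi (hq h)
  -- After the rotation `m` is first and highest, so it separates no pair.
  have hk : KingOn r q (S.erase m) := by
    intro a b hab
    refine hS r hr a b ⟨mem_of_mem_erase hab.1, mem_of_mem_erase hab.2.1, hab.2.2.1, fun c hc => ?_⟩
    by_cases hcm : c = m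
    · subst hcm
      have := hrm a hab.1
      have := hrm b hab.2.1
      have := hqm a hab.1
      have := hqm b hab.2.1
      unfold IsBetween
      omega
    · exact hab.2.2.2 c (mem_erase.2 ⟨hcm, hc⟩)
  have hcard := card_erase_of_mem hm
  rcases Nat.lt_or_ge 2 #S with h3 | h3
  · obtain ⟨a, b, c, d, hsub, hQ⟩ := hk.exists_quad hr.1 hq (by omega)
    refine ⟨{m, a, b, c, d}, insert_subset hm (hsub.trans (erase_subset _ _)),
      hQ.kingFor_insert hr (hrm a (hsub (by simp))) (hqm b (hsub (by simp)))
        (hqm c (hsub (by simp))), ?_⟩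
    have hma := hrm a (hsub (by simp))
    obtain ⟨h1, h2, h3, -⟩ := hQ
    have ne : ∀ y z, r y < r z → y ≠ z := fun y z h => by rintro rfl; omega
    rw [card_insert_of_notMem, card_insert_of_notMem, card_insert_of_notMem, card_pair]
    · exact ne _ _ h3
    · simp [ne b c (by omega), ne b d (by omega)]
    · simp [ne a b (by omega), ne a c (by omega), ne a d (by omega)]
    · simp [ne m a (by omega), ne m b (by omega), ne m c (by omega), ne m d (by omega)]
  · obtain ⟨a, b, hab, rfl⟩ := card_eq_two.1 (le_antisymm h3 h2)
    exact absurd (bond_pair hab) (hS p hpp a b)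
end KingPoset

/-! ### From point sets back to permutations. -/

namespace KingPoset

open Finset

lemma KingFor.exists_btw {ι : Type*} [DecidableEq ι] [Fintype ι] {p q : ι → ℤ} {T : Finset ι}
    (hp : Function.Injective p) (hT : KingFor (rotations p) q T) {a b : ι} (ha : a ∈ T) (hb : b ∈ T)
    (hne : a ≠ b) (hab : (∀ c ∈ T, ¬ IsBetween p a c b) ∨ ∀ c ∈ T, p a ≤ p c ∧ p c ≤ p b) :
    ∃ c ∈ T, IsBetween q a c b := by
  have hpp : p ∈ rotations p := ⟨hp, fun _ _ _ => Iff.rfl⟩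
  by_contra! hno
  rcases hab with hab | hab
  · exact hT p hpp a b ⟨ha, hb, hne, fun c hc => ⟨hab c hc, hno c hc⟩⟩
  -- Within `T` this moves only the first point `a`, to just beyond the last point `b`.
  · obtain ⟨r, hr, M, hM, hr'⟩ := exists_rotation hpp (p a + 1)
    refine hT r hr a b ⟨ha, hb, hne, fun c hc => ⟨?_, hno c hc⟩⟩
    have h1 := hab c hc
    have h2 := hab b hb
    have h3 := hM b a
    have h4 : p a ≠ p b := fun h => hne (hp h)
    unfold IsBetween
    rw [hr' a, hr' b, hr' c]
    by_cases hca : c = a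
    · subst hca; split_ifs <;> omega
    · have : p c ≠ p a := fun h => hca (hp h)
      split_ifs <;> omega

end KingPoset

namespace FinPerm

open Finset KingPoset

/-- The position of an entry, as an integer. -/
def pos {n : ℕ} (i : Fin n) : ℤ := ((i : ℕ) : ℤ)

/-- The entry at a position, as an integer. -/
def val (σ : FinPerm) (i : Fin σ.1) : ℤ := ((σ.2 i : ℕ) : ℤ)

lemma pos_injective {n : ℕ} : Function.Injective (pos : Fin n → ℤ) := fun i j h => by
  unfold pos at h; omega

lemma val_injective (σ : FinPerm) : Function.Injective σ.val := fun i j h => by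
  apply σ.2.injective
  unfold val at h; omega

lemma val_lt_val {σ : FinPerm} {i j : Fin σ.1} : σ.val i < σ.val j ↔ σ.2 i < σ.2 j := by
  unfold val; omega

lemma pos_lt_pos {n : ℕ} {i j : Fin n} : pos i < pos j ↔ i < j := by
  unfold pos; omega

lemma one_lt_abs_iff {σ : FinPerm} {i j : Fin σ.1} (h : i ≠ j) :
    1 < |((σ.2 i : ℕ) : ℤ) - ((σ.2 j : ℕ) : ℤ)| ↔ ∃ k, IsBetween σ.val i k j := by
  have hne : ((σ.2 i : ℕ) : ℤ) ≠ ((σ.2 j : ℕ) : ℤ) := fun h' => h (σ.val_injective h')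
  rw [lt_abs]
  constructor
  · intro h
    rcases h with h | h
    · refine ⟨σ.2.symm ⟨(σ.2 j : ℕ) + 1, by omega⟩, Or.inr ?_⟩
      simp only [val, Equiv.apply_symm_apply]
      omega
    · refine ⟨σ.2.symm ⟨(σ.2 i : ℕ) + 1, by omega⟩, Or.inl ?_⟩
      simp only [val, Equiv.apply_symm_apply]
      omega
  · rintro ⟨k, h⟩
    unfold IsBetween val at h
    omega

lemma not_btw_pos {n : ℕ} {i j k : Fin n} (h : (i : ℕ) + 1 = j) : ¬ IsBetween pos i k j := by
  unfold IsBetween pos; omega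

/-- `g` embeds `τ` into `σ` with image `T`. -/
structure Embeds (τ σ : FinPerm) (g : Fin τ.1 → Fin σ.1) (T : Finset (Fin σ.1)) : Prop where
  strictMono : StrictMono g
  lt_iff : ∀ i j, τ.2 i < τ.2 j ↔ σ.2 (g i) < σ.2 (g j)
  image : univ.image g = T

variable {π σ τ : FinPerm} {g : Fin τ.1 → Fin σ.1} {T : Finset (Fin σ.1)}

lemma Embeds.mem (h : Embeds τ σ g T) (i) : g i ∈ T := by simp [← h.image]

lemma Embeds.exists_of_mem (h : Embeds τ σ g T) {t} (ht : t ∈ T) : ∃ i, g i = t := by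
  simpa [← h.image] using ht

lemma Embeds.card (h : Embeds τ σ g T) : #T = τ.1 := by
  rw [← h.image, card_image_of_injective _ h.strictMono.injective]; simp

lemma Embeds.btw_pos (h : Embeds τ σ g T) {i j k} : IsBetween pos (g i) (g k) (g j) ↔ IsBetween pos i k j := by
  simp only [IsBetween, pos_lt_pos, h.strictMono.lt_iff_lt]

lemma Embeds.btw_val (h : Embeds τ σ g T) {i j k} :
    IsBetween σ.val (g i) (g k) (g j) ↔ IsBetween τ.val i k j := by
  simp only [IsBetween, val_lt_val, h.lt_iff]

lemma king_of_kingOn (h : Embeds τ σ g T) (h1 : 1 ≤ τ.size) (hT : KingOn pos σ.val T) :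
    τ ∈ King := by
  refine ⟨h1, fun i j hij => ?_⟩
  have hne : j ≠ i := by rintro rfl; omega
  rw [one_lt_abs_iff hne]
  by_contra! hno
  refine hT (g j) (g i) ⟨h.mem _, h.mem _, h.strictMono.injective.ne hne, fun c hc => ?_⟩
  obtain ⟨k, rfl⟩ := h.exists_of_mem hc
  rw [h.btw_pos, h.btw_val]
  exact ⟨fun h' => not_btw_pos hij h'.symm, hno k⟩

lemma kingOn_of_king (h : Embeds τ σ g T) (hτ : τ ∈ King) : KingOn pos σ.val T := by
  rintro a b ⟨ha, hb, hne, hno⟩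
  obtain ⟨i, rfl⟩ := h.exists_of_mem ha
  obtain ⟨j, rfl⟩ := h.exists_of_mem hb
  have hij : i ≠ j := fun h => hne (by rw [h])
  have hno' : ∀ k, ¬ IsBetween pos i k j ∧ ¬ IsBetween τ.val i k j := fun k => by
    rw [← h.btw_pos, ← h.btw_val]; exact hno _ (h.mem k)
  clear hno
  have hij' : (i : ℕ) + 1 = j ∨ (j : ℕ) + 1 = i := by
    by_contra! h'
    rcases lt_or_gt_of_ne hij with hlt | hlt
    · refine (hno' ⟨i + 1, by omega⟩).1 ?_
      unfold IsBetween pos; simp only; omega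
    · refine (hno' ⟨j + 1, by omega⟩).1 ?_
      unfold IsBetween pos; simp only; omega
  rcases hij' with h' | h'
  · obtain ⟨k, hk⟩ := (one_lt_abs_iff hij.symm).1 (hτ.2 i j h')
    exact (hno' k).2 hk.symm
  · obtain ⟨k, hk⟩ := (one_lt_abs_iff hij).1 (hτ.2 j i h')
    exact (hno' k).2 hk

lemma cylKing_of_kingFor (h : Embeds τ σ g T) (h1 : 1 ≤ τ.size)
    (hT : KingFor (rotations pos) σ.val T) : τ ∈ CylKing := by
  refine ⟨king_of_kingOn h h1 (hT pos ⟨pos_injective, fun _ _ _ => Iff.rfl⟩), ?_⟩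
  intro i j hi hj hne
  rw [one_lt_abs_iff hne]
  obtain ⟨c, hc, hbtw⟩ := hT.exists_btw pos_injective (h.mem i) (h.mem j)
    (h.strictMono.injective.ne hne) (Or.inr fun c hc => by
      obtain ⟨k, rfl⟩ := h.exists_of_mem hc
      have h1 : g i ≤ g k := h.strictMono.monotone (by rw [Fin.le_def]; omega)
      have h2 : g k ≤ g j := h.strictMono.monotone (by rw [Fin.le_def]; omega)
      unfold pos; omega)
  obtain ⟨k, rfl⟩ := h.exists_of_mem hc
  exact ⟨k, h.btw_val.1 hbtw⟩

/-- A bond seen only by a rotated cut has every other point of `T` between its ends, so these are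
the first and last entries of `τ`. -/
lemma kingFor_of_cylKing (h : Embeds τ σ g T) (hτ : τ ∈ CylKing) :
    KingFor (rotations pos) σ.val T := by
  have hpp : (pos : Fin σ.1 → ℤ) ∈ rotations pos := ⟨pos_injective, fun _ _ _ => Iff.rfl⟩
  rintro r hr a b ⟨ha, hb, hne, hno⟩
  rcases isFrame_rotations.2 pos hpp r hr a b with h' | h'
  · exact kingOn_of_king h hτ.1 a b ⟨ha, hb, hne, fun c hc => ⟨fun hc' => (hno c hc).1 ((h' c).2 hc'),
      (hno c hc).2⟩⟩
  obtain ⟨i, rfl⟩ := h.exists_of_mem ha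
  obtain ⟨j, rfl⟩ := h.exists_of_mem hb
  have hij : i ≠ j := fun h => hne (by rw [h])
  have hall : ∀ k, k ≠ i → k ≠ j → IsBetween pos i k j := by
    intro k hki hkj
    rw [← h.btw_pos]
    by_contra h3
    exact (hno _ (h.mem k)).1 ((h' _ (h.strictMono.injective.ne hki)
      (h.strictMono.injective.ne hkj)).2 h3)
  have hval : ∀ k, ¬ IsBetween τ.val i k j := fun k h3 => (hno _ (h.mem k)).2 (h.btw_val.2 h3)
  have key : ∀ i j : Fin τ.1, i < j → (∀ k, k ≠ i → k ≠ j → IsBetween pos i k j) →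
      ∃ k, IsBetween τ.val i k j := by
    intro i j hlt hall
    rw [← one_lt_abs_iff hlt.ne]
    have hpos : 0 < τ.1 := by omega
    refine hτ.2 i j ?_ ?_ hlt.ne
    · by_contra hi
      have := hall ⟨0, hpos⟩ (fun h => hi (by rw [← h])) (fun h => by
        rw [← h] at hlt; simp [Fin.lt_def] at hlt)
      unfold IsBetween pos at this
      simp only at this
      omega
    · by_contra hj
      have := hall ⟨τ.1 - 1, by omega⟩ (fun h => by
        rw [← h] at hlt; simp only [Fin.lt_def] at hlt; omega) (fun h => hj (by rw [← h]; simp only; omega))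
      unfold IsBetween pos at this
      simp only at this
      omega
  rcases lt_or_gt_of_ne hij with hlt | hlt
  · obtain ⟨k, hk⟩ := key i j hlt hall
    exact hval k hk
  · obtain ⟨k, hk⟩ := key j i hlt (fun k h1 h2 => (hall k h2 h1).symm)
    exact hval k hk.symm

lemma embeds_refl (σ : FinPerm) : Embeds σ σ id univ :=
  ⟨strictMono_id, fun _ _ => Iff.rfl, by simp⟩

/-- Every set of positions carries a pattern. -/
lemma exists_embeds (σ : FinPerm) (T : Finset (Fin σ.1)) :
    ∃ (τ : FinPerm) (g : Fin τ.1 → Fin σ.1), Embeds τ σ g T := by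
  let e := T.orderIsoOfFin rfl
  let e' := (T.map σ.2.toEmbedding).orderIsoOfFin (card_map _)
  let m : T ≃ T.map σ.2.toEmbedding :=
    { toFun := fun t => ⟨σ.2 t, by simp⟩
      invFun := fun t => ⟨σ.2.symm t, by
        obtain ⟨t, ht⟩ := t
        simpa [Finset.mem_map_equiv] using ht⟩
      left_inv := fun t => by simp
      right_inv := fun t => by simp }
  refine ⟨⟨#T, (e.toEquiv.trans m).trans e'.symm.toEquiv⟩, fun i => e i, ?_, ?_, ?_⟩
  · exact fun i j hij => e.strictMono hij
  · intro i j
    change e'.symm (m (e i)) < e'.symm (m (e j)) ↔ _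
    rw [e'.symm.lt_iff_lt]
    rfl
  · ext t
    simp only [mem_image, mem_univ, true_and]
    constructor
    · rintro ⟨i, rfl⟩
      exact (e i).2
    · intro ht
      exact ⟨e.symm ⟨t, ht⟩, by simp⟩

lemma PatternLT.exists_embeds (h : PatternLT π σ) : ∃ f S, Embeds π σ f S :=
  ⟨h.2.choose, _, h.2.choose_spec.1, h.2.choose_spec.2, rfl⟩

lemma Embeds.patternLT (h : Embeds τ σ g T) (hT : #T < σ.1) : PatternLT τ σ :=
  ⟨by have := h.card; unfold size; omega, g, h.strictMono, h.lt_iff⟩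

/-- An embedding of `π` into `σ` with image in `T` is an embedding into the pattern of `T`. -/
lemma Embeds.patternLT_of_mem (h : Embeds τ σ g T) (hlt : π.1 < #T) (f : Fin π.1 → Fin σ.1)
    (hf : StrictMono f) (hf' : ∀ i j, π.2 i < π.2 j ↔ σ.2 (f i) < σ.2 (f j)) (hfT : ∀ i, f i ∈ T) :
    PatternLT π τ := by
  choose k hk using fun i => h.exists_of_mem (hfT i)
  refine ⟨by rw [h.card] at hlt; exact hlt, k, fun i j hij => ?_, fun i j => ?_⟩
  · rw [← h.strictMono.lt_iff_lt, hk, hk]; exact hf hij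
  · rw [h.lt_iff, hk, hk, hf']

lemma PatternLT.trans {ρ : FinPerm} (h : PatternLT π τ) (h' : PatternLT τ ρ) : PatternLT π ρ := by
  obtain ⟨h1, f, hf, hf'⟩ := h
  obtain ⟨h2, k, hk, hk'⟩ := h'
  exact ⟨h1.trans h2, k ∘ f, hk.comp hf, fun i j => by rw [hf', hk']; rfl⟩

lemma exists_king_between (hσ : σ ∈ King) (hπ : π ∈ King) (h : PatternLT π σ)
    (hgap : π.size + 3 < σ.size) : ∃ τ ∈ King, PatternLT π τ ∧ PatternLT τ σ := by
  obtain ⟨f, S, hf⟩ := h.exists_embeds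
  have hS := kingOn_of_king hf hπ
  have hN := kingOn_of_king (embeds_refl σ) hσ
  have hπ1 : 1 ≤ π.1 := hπ.1
  have hcard := hf.card
  unfold size at hgap
  obtain ⟨W, hW, h1, h2, r, hr, hr'⟩ := exists_between pos_injective σ.val_injective hS hN
    (by simp; omega)
  rw [Fintype.card_fin] at h2
  obtain ⟨τ, g, hg⟩ := exists_embeds σ W
  have hτ := hg.card
  refine ⟨τ, king_of_kingOn hg (by unfold size; omega) hW, ?_, hg.patternLT h2⟩
  refine hg.patternLT_of_mem (by omega) (fun i => r (f i)) ?_ ?_ (fun i => hr _ (hf.mem i))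
  · intro i j hij
    exact pos_lt_pos.1 ((hr' _ (hf.mem i) _ (hf.mem j)).1 (pos_lt_pos.2 (hf.strictMono hij)))
  · intro i j
    rw [hf.lt_iff, ← val_lt_val, ← val_lt_val]
    exact (hr' _ (hf.mem i) _ (hf.mem j)).2

lemma exists_cylKing_between (hσ : σ ∈ CylKing) (hπ : π ∈ CylKing) (h : PatternLT π σ)
    (hgap : π.size + 4 < σ.size) : ∃ τ ∈ CylKing, PatternLT π τ ∧ PatternLT τ σ := by
  obtain ⟨f, S, hf⟩ := h.exists_embeds
  have hS := kingFor_of_cylKing hf hπ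
  have hN := kingFor_of_cylKing (embeds_refl σ) hσ
  have hπ1 : 1 ≤ π.1 := hπ.1.1
  have hcard := hf.card
  unfold size at hgap
  -- Recutting needs three points of `S`, which are available unless `π` is `[1]`; that case uses a
  -- five-point cylindrical king inside `σ`.
  rcases Nat.lt_or_ge 1 π.1 with h2 | h2
  · have h3 : 3 ≤ #S := by
      obtain ⟨R, hR, -, hR5⟩ := exists_card_eq_five pos_injective σ.val_injective hS (by omega)
      have := card_le_card hR
      omega
    obtain ⟨W, hSW, hW, h4, h5⟩ := exists_between_rotations σ.val_injective hS h3 hN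
      (by simp; omega)
    rw [Fintype.card_fin] at h5
    obtain ⟨τ, g, hg⟩ := exists_embeds σ W
    have hτ := hg.card
    exact ⟨τ, cylKing_of_kingFor hg (by unfold size; omega) hW,
      hg.patternLT_of_mem (by omega) f hf.strictMono hf.lt_iff (fun i => hSW (hf.mem i)),
      hg.patternLT h5⟩
  · obtain ⟨R, -, hR, hR5⟩ := exists_card_eq_five pos_injective σ.val_injective hN
      (by simp; omega)
    obtain ⟨τ, g, hg⟩ := exists_embeds σ R
    have hτ := hg.card
    refine ⟨τ, cylKing_of_kingFor hg (by unfold size; omega) hR, ⟨by unfold size; omega,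
      fun _ => ⟨0, by omega⟩, fun i j hij => ?_, fun i j => ?_⟩, hg.patternLT (by omega)⟩
    · rw [Fin.lt_def] at hij; omega
    · have : i = j := Fin.ext (by omega)
      simp [this]

/-- Intermediate elements are inserted repeatedly above `π` until the distance to `σ` is at most 4.
-/
lemma exists_cylKing_near (hσ : σ ∈ CylKing) :
    ∀ d, ∀ π ∈ CylKing, PatternLT π σ → σ.size = π.size + d → 4 < d →
      ∃ τ ∈ CylKing, PatternLT π τ ∧ PatternLT τ σ ∧ σ.size ≤ τ.size + 4 := by
  intro d
  induction d using Nat.strong_induction_on with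
  | _ d ih =>
    intro π hπ h hd h4
    obtain ⟨τ, hτ, h1, h2⟩ := exists_cylKing_between hσ hπ h (by omega)
    by_cases h5 : σ.size ≤ τ.size + 4
    · exact ⟨τ, hτ, h1, h2, h5⟩
    have h6 := h1.1
    have h7 := h2.1
    obtain ⟨ρ, hρ, h8, h9⟩ := ih (σ.size - τ.size) (by omega) τ hτ h2 (by omega) (by omega)
    exact ⟨ρ, hρ, h1.trans h8, h9⟩

/-! ### Covering pairs attaining the bounds. -/

lemma coveredIn_king : CoveredIn King ⟨1, 1⟩
    ⟨4, ⟨![1, 3, 0, 2], ![2, 0, 3, 1], by decide, by decide⟩⟩ := by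
  refine ⟨⟨le_rfl, fun i j hij => by
    have h1 : (i : ℕ) < 1 := i.2
    have h2 : (j : ℕ) < 1 := j.2
    omega⟩, ⟨by decide, by decide⟩,
    ⟨by decide, fun _ => 0, fun i j hij => absurd hij (by simp [Subsingleton.elim i j]), fun i j => ?_⟩, ?_⟩
  · simp [Subsingleton.elim i j]
  · rintro ⟨τ, hτ, h1, h2⟩
    have h3 : 1 < τ.1 := h1.1
    have h4 : τ.1 < 4 := h2.1
    -- A king permutation with two entries contains 2413 or 3142, hence has four positions.
    obtain ⟨a, b, c, d, -, h5, h6, h7, -⟩ := (kingOn_of_king (embeds_refl τ) hτ).exists_quad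
      pos_injective τ.val_injective (by simp; omega)
    unfold pos at h5 h6 h7
    omega

/-- The entries of `[579683142]`, lowered by one. -/
def entries : Fin 9 → Fin 9 := ![4, 6, 8, 5, 7, 2, 0, 3, 1]

set_option synthInstance.maxSize 1000 in
set_option synthInstance.maxHeartbeats 200000 in
-- 13524 occurs only in the first five positions. Hypotheses alternate with quantifiers so that
-- `decide` prunes early.
lemma eq_of_pattern : ∀ a b : Fin 9, a < b → entries a < entries b → ∀ c, b < c →
    entries b < entries c → ∀ d, c < d → entries a < entries d → entries d < entries b →
    ∀ e, d < e → entries b < entries e → entries e < entries c →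
    a = 0 ∧ b = 1 ∧ c = 2 ∧ d = 3 ∧ e = 4 := by
  decide

/-- The bits select among the last four positions. Every choice other than none or all leaves a
cyclic bond; the last alternative is a bond between the first and last selected positions. -/
lemma exists_bond_of_between : ∀ x y z w : Bool, (x || y || z || w) = true →
    (x && y && z && w) = false →
    ∃ a b : Fin 9, a < b ∧ ![true, true, true, true, true, x, y, z, w] a = true ∧
      ![true, true, true, true, true, x, y, z, w] b = true ∧
      (∀ c, ![true, true, true, true, true, x, y, z, w] c = true →
        ¬ ((entries a < entries c ∧ entries c < entries b) ∨
          (entries b < entries c ∧ entries c < entries a))) ∧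
      ((∀ c, ![true, true, true, true, true, x, y, z, w] c = true → ¬ (a < c ∧ c < b)) ∨
       ∀ c, ![true, true, true, true, true, x, y, z, w] c = true → a ≤ c ∧ c ≤ b) := by
  decide
end FinPerm

namespace FinPerm

open Finset KingPoset

lemma coveredIn_cylKing : CoveredIn CylKing perm13524 perm579683142 := by
  refine ⟨⟨⟨by decide, by decide⟩, by decide⟩, ⟨⟨by decide, by decide⟩, by decide⟩,
    ⟨by decide, (![0, 1, 2, 3, 4] : Fin 5 → Fin 9), fun i j h =>
      (by decide : ∀ i j : Fin 5, i < j → (![0, 1, 2, 3, 4] : Fin 5 → Fin 9) i <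
        (![0, 1, 2, 3, 4] : Fin 5 → Fin 9) j) i j h, by decide⟩, ?_⟩
  rintro ⟨τ, hτ, ⟨h1, f, hf, hf'⟩, h2⟩
  obtain ⟨g, T, hg⟩ := h2.exists_embeds
  have hT := kingFor_of_cylKing hg hτ
  have h3 : 5 < τ.1 := h1
  have h4 : τ.1 < 9 := h2.1
  have hlt : ∀ i j : Fin 5, i < j → g (f i) < g (f j) := fun i j h => hg.strictMono (hf h)
  have hent : ∀ i j : Fin 5, perm13524.2 i < perm13524.2 j →
      entries (g (f i)) < entries (g (f j)) := fun i j h => (hg.lt_iff _ _).1 ((hf' i j).1 h)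
  obtain ⟨e0, e1, e2, e3, e4⟩ := eq_of_pattern (g (f (0 : Fin 5))) (g (f (1 : Fin 5)))
    (hlt 0 1 (by decide)) (hent 0 1 (by decide)) (g (f (2 : Fin 5))) (hlt 1 2 (by decide))
    (hent 1 2 (by decide)) (g (f (3 : Fin 5))) (hlt 2 3 (by decide)) (hent 0 3 (by decide))
    (hent 3 1 (by decide)) (g (f (4 : Fin 5))) (hlt 3 4 (by decide)) (hent 1 4 (by decide))
    (hent 4 2 (by decide))
  change Finset (Fin 9) at T
  have hcard : #T = τ.1 := hg.card
  have m0 : (0 : Fin 9) ∈ T := e0 ▸ hg.mem _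
  have m1 : (1 : Fin 9) ∈ T := e1 ▸ hg.mem _
  have m2 : (2 : Fin 9) ∈ T := e2 ▸ hg.mem _
  have m3 : (3 : Fin 9) ∈ T := e3 ▸ hg.mem _
  have m4 : (4 : Fin 9) ∈ T := e4 ▸ hg.mem _
  have hmem : ∀ c : Fin 9, ![true, true, true, true, true, decide ((5 : Fin 9) ∈ T),
      decide ((6 : Fin 9) ∈ T), decide ((7 : Fin 9) ∈ T), decide ((8 : Fin 9) ∈ T)] c = true ↔
      c ∈ T := by
    intro c
    fin_cases c <;> simp [m0, m1, m2, m3, m4]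
  obtain ⟨a, b, hab, ha, hb, hv, hp⟩ := exists_bond_of_between (decide ((5 : Fin 9) ∈ T))
    (decide ((6 : Fin 9) ∈ T)) (decide ((7 : Fin 9) ∈ T)) (decide ((8 : Fin 9) ∈ T)) (by
      by_contra hno
      simp only [Bool.or_eq_true, decide_eq_true_eq, not_or] at hno
      have hsub : T ⊆ {0, 1, 2, 3, 4} := by
        intro c hc
        fin_cases c <;> simp_all
      have := card_le_card hsub
      have h5 : #({0, 1, 2, 3, 4} : Finset (Fin 9)) = 5 := by decide
      omega) (by
      by_contra hno
      simp only [Bool.not_eq_false, Bool.and_eq_true, decide_eq_true_eq] at hno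
      have : T = univ := by
        ext c
        fin_cases c <;> simp_all
      rw [this] at hcard
      have h5 : #(univ : Finset (Fin 9)) = 9 := by decide
      omega)
  simp only [hmem] at ha hb hv hp
  obtain ⟨c, hc, hbtw⟩ := hT.exists_btw pos_injective ha hb hab.ne (by
    rcases hp with hp | hp
    · refine Or.inl fun c hc h => hp c hc ?_
      unfold IsBetween pos at h
      omega
    · refine Or.inr fun c hc => ?_
      have := hp c hc
      unfold pos
      omega)
  refine hv c hc ?_
  rcases hbtw with h | h
  exacts [Or.inl ⟨val_lt_val.1 h.1, val_lt_val.1 h.2⟩, Or.inr ⟨val_lt_val.1 h.1, val_lt_val.1 h.2⟩]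

end FinPerm

theorem mainTheorem1 :
    (∀ σ ∈ FinPerm.CylKing, ∀ π ∈ FinPerm.CylKing,
      FinPerm.PatternLT π σ → π.size + 4 < σ.size →
        ∃ τ ∈ FinPerm.CylKing,
          FinPerm.PatternLT π τ ∧ FinPerm.PatternLT τ σ ∧ σ.size ≤ τ.size + 4) ∧
    IsGreatest (FinPerm.gaps FinPerm.CylKing) 4 ∧
    IsGreatest (FinPerm.gaps FinPerm.King) 3 ∧
    FinPerm.CoveredIn FinPerm.CylKing FinPerm.perm13524 FinPerm.perm579683142 ∧
    FinPerm.perm579683142.size = FinPerm.perm13524.size + 4 := by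
  refine ⟨fun σ hσ π hπ h hgap => FinPerm.exists_cylKing_near hσ (σ.size - π.size) π hπ h
    (by omega) (by omega), ⟨⟨_, _, FinPerm.coveredIn_cylKing, rfl⟩, ?_⟩,
    ⟨⟨_, _, FinPerm.coveredIn_king, rfl⟩, ?_⟩, FinPerm.coveredIn_cylKing, rfl⟩
  · rintro d ⟨π, σ, ⟨hπ, hσ, h, hno⟩, hd⟩
    by_contra h4
    exact hno (FinPerm.exists_cylKing_between hσ hπ h (by omega))
  · rintro d ⟨π, σ, ⟨hπ, hσ, h, hno⟩, hd⟩
    by_contra h4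
    exact hno (FinPerm.exists_king_between hσ hπ h (by omega))
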